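/- **Setting.** Let $T\ge 1$ be an integer and let $W_T(s)$, $s\in G:=\{0,\tfrac1T,\tfrac2T,\dots,1\}$, be unitary operators on a complex Hilbert space; $\|\cdot\|$ is the operator (spectral) norm. The actual evolution is $U_T(0)=I$, $U_T(s+\tfrac1T)=W_T(s)\,U_T(s)$. For each $s\in G$ let the spectrum of $W_T(s)$ be the disjoint union of $\sigma_P(s)$ (the spectrum of interest) and $\sigma_Q(s)$, and let $P_T(s)$ be the spectral projection of $W_T(s)$ onto $\sigma_P(s)$, $Q_T(s)=I-P_T(s)$. The ideal adiabatic evolution is $$U_T^A(0)=I,\qquad U_T^A(s+\tfrac1T)=V_T(s)\,W_T(s)\,U_T^A(s),$$ where $V_T(s)=(S S^\dagger)^{-1/2}S$ with $S=P_T(s+\tfrac1T)P_T(s)+Q_T(s+\tfrac1T)Q_T(s)$. *Differences.* $DW_T(s)=W_T(s+\tfrac1T)-W_T(s)$ and $D^{(2)}W_T(s)=DW_T(s+\tfrac1T)-DW_T(s)$. Let $c_k(s)$ be real numbers with $\|D^{(k)}W_T(s)\|\le c_k(s)/T^k$ for $k=1,2$ and all $s\in G\cap[0,1-k/T]$, and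 put $$\hat c_k(s)=\max\{c_k(s'):\ s'\in\{s-\tfrac1T,s,s+\tfrac1T\}\cap[0,1-k/T]\}.$$ *Gaps.* For $k=0,1,2$ and $s\in G\cap[0,1-k/T]$ let $\sigma_P^{(k)}(s)\supseteq\bigcup_{l=0}^k\sigma_P(s+l/T)$ and $\sigma_Q^{(k)}(s)\supseteq\bigcup_{l=0}^k\sigma_Q(s+l/T)$ be disjoint closed arcs of the unit circle, and let $\Delta_k(s)$ be the minimum angular distance between them. Put $\Delta(s)=\Delta_2(s)$ for $0\le s\le 1-2/T$, $\Delta(1-1/T)=\Delta_1(1-1/T)$, $\Delta(1)=\Delta_0(1)$, and $$\check\Delta(s)=\min\{\Delta(s'):\ s'\in\{s-\tfrac1T,s,s+\tfrac1T\}\cap[0,1]\}.$$ **Theorem (The Second Discrete Adiabatic Theorem).** If $T\ge\max_{s\in G}4\hat c_1(s)/\check\Delta(s)$, then for every $s\in[0,1]$ with $sT\in\mathbb N$ $$\begin{aligned}\|U_T(s)-U_T^A(s)\|\le{}&\frac{12\,\hat c_1(0)}{T\check\Delta(0)^2}+\frac{12\,\hat c_1(s)}{T\check\Delta(s)^2}+\frac{6\,\hat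 c_1(s)}{T\check\Delta(s)}+305\sum_{n=1}^{sT-1}\frac{\hat c_1(n/T)^2}{T^2\check\Delta(n/T)^3}\\&+44\sum_{n=0}^{sT-1}\frac{\hat c_1(n/T)^2}{T^2\check\Delta(n/T)^2}+32\sum_{n=1}^{sT-1}\frac{\hat c_2(n/T)}{T^2\check\Delta(n/T)^2}.\end{aligned}$$ -/

import Mathlib

/-!
Throughout, `T` is the total number of steps and the discrete time `s = n / T` is represented by
its index `n`, so that `W n` stands for the walk operator `W_T(n / T)`, a shift of `s` by `1 / T` is
a shift of `n` by `1`, and `s ∈ [0, 1]` means `n ≤ T`.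
-/

noncomputable section

namespace DiscreteAdiabatic

/-! ### Spectral projections and the two evolutions -/

section Operators

variable {H : Type*} [NormedAddCommGroup H] [InnerProductSpace ℂ H] [CompleteSpace H]

/-- The spectral projection of the unitary (more generally, normal) operator `W` onto the part `σ`
of its spectrum: the functional calculus of the indicator function of `σ`.  It is meaningful when
`σ ∩ spectrum ℂ W` is open and closed in the spectrum, which holds whenever this part and the rest
of the spectrum lie in two disjoint closed arcs. -/
def spectralProj (W : H →L[ℂ] H) (σ : Set ℂ) : H →L[ℂ] H :=
  cfc (σ.indicator (fun _ => (1 : ℂ))) W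

/-- `S = P' P + Q' Q`, where `Q = 1 - P` and `Q' = 1 - P'`. -/
def transferS (P' P : H →L[ℂ] H) : H →L[ℂ] H :=
  P' * P + (1 - P') * (1 - P)

/-- `v = √(S S†)`. -/
def transferAbs (P' P : H →L[ℂ] H) : H →L[ℂ] H :=
  CFC.sqrt (transferS P' P * star (transferS P' P))

/-- `V = v⁻¹ S`, the unitary of the left polar decomposition of `S` (when `v` is invertible). -/
def transferV (P' P : H →L[ℂ] H) : H →L[ℂ] H :=
  Ring.inverse (transferAbs P' P) * transferS P' P

/-- The actual evolution: `U(0) = 1`, `U(n + 1) = W(n) U(n)`, that is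
`U(n) = W(n - 1) ⋯ W(1) W(0)`. -/
def evolution (W : ℕ → H →L[ℂ] H) : ℕ → H →L[ℂ] H
  | 0 => 1
  | n + 1 => W n * evolution W n

/-- The adiabatic walk operator `W^A(n) = V(n + 1, n) W(n)`, where `V(n + 1, n)` is built from the
spectral projections of `W (n + 1)` and `W n` onto the spectra of interest `σP (n + 1)`, `σP n`. -/
def adiabaticWalk (W : ℕ → H →L[ℂ] H) (σP : ℕ → Set ℂ) (n : ℕ) : H →L[ℂ] H :=
  transferV (spectralProj (W (n + 1)) (σP (n + 1))) (spectralProj (W n) (σP n)) * W n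

/-- The ideal adiabatic evolution: `U^A(0) = 1`, `U^A(n + 1) = W^A(n) U^A(n)`. -/
def adiabaticEvolution (W : ℕ → H →L[ℂ] H) (σP : ℕ → Set ℂ) : ℕ → H →L[ℂ] H :=
  evolution (adiabaticWalk W σP)

end Operators

/-! ### Multistep differences -/

/-- `ĉ_k(n)`: the maximum of `c k m` over the neighbours `m ∈ {n - 1, n, n + 1}` of `n` with
`0 ≤ m ≤ T - k`. -/
def cHat (T : ℕ) (c : ℕ → ℕ → ℝ) (k n : ℕ) : ℝ :=
  sSup (c k '' {m : ℕ | (m + 1 = n ∨ m = n ∨ m = n + 1) ∧ m + k ≤ T})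

/-! ### Arcs and multistep gaps -/

/-- A (nonempty, closed) arc of the unit circle of the complex plane. -/
def IsArc (A : Set ℂ) : Prop :=
  ∃ a b : ℝ, a ≤ b ∧ A = (fun θ : ℝ => Complex.exp (θ * Complex.I)) '' Set.Icc a b

/-- The minimum angular distance between two subsets of the unit circle; the angular distance of
two points is the unoriented angle in `[0, π]` between them. -/
def angularDist (A B : Set ℂ) : ℝ :=
  sInf (Set.image2 InnerProductGeometry.angle A B)

/-- `AP k n` and `AQ k n` are disjoint arcs that contain the spectra of interest, respectively the
complementary spectra, of the `k + 1` successive steps `n, n + 1, …, n + k`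
(for `k = 0, 1, 2`, as long as these steps do not go beyond the last one, `T`). -/
structure AreMultistepArcs (T : ℕ) (σP σQ : ℕ → Set ℂ) (AP AQ : ℕ → ℕ → Set ℂ) : Prop where
  isArc_left : ∀ k n, k ≤ 2 → n + k ≤ T → IsArc (AP k n)
  isArc_right : ∀ k n, k ≤ 2 → n + k ≤ T → IsArc (AQ k n)
  disjoint : ∀ k n, k ≤ 2 → n + k ≤ T → Disjoint (AP k n) (AQ k n)
  subset_left : ∀ k n, k ≤ 2 → n + k ≤ T → (⋃ l ∈ Set.Iic k, σP (n + l)) ⊆ AP k n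
  subset_right : ∀ k n, k ≤ 2 → n + k ≤ T → (⋃ l ∈ Set.Iic k, σQ (n + l)) ⊆ AQ k n

/-- `Δ_k(n)`: the minimum angular distance between the arcs for `k + 1` successive steps. -/
def gapK (AP AQ : ℕ → ℕ → Set ℂ) (k n : ℕ) : ℝ :=
  angularDist (AP k n) (AQ k n)

/-- `Δ(n)`: it is `Δ_2(n)` for `n ≤ T - 2`, `Δ_1(n)` for `n = T - 1`, and `Δ_0(n)` for `n = T`. -/
def gap (T : ℕ) (AP AQ : ℕ → ℕ → Set ℂ) (n : ℕ) : ℝ :=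
  if n + 2 ≤ T then gapK AP AQ 2 n
  else if n + 1 = T then gapK AP AQ 1 n
  else gapK AP AQ 0 n

/-- `Δ̌(n)`: the minimum of `Δ` over the neighbours `m ∈ {n - 1, n, n + 1}` of `n` with
`0 ≤ m ≤ T`. -/
def gapCheck (T : ℕ) (AP AQ : ℕ → ℕ → Set ℂ) (n : ℕ) : ℝ :=
  sInf (gap T AP AQ '' {m : ℕ | (m + 1 = n ∨ m = n ∨ m = n + 1) ∧ m ≤ T})

end DiscreteAdiabatic

end

/-!
Up to second order, the transport operator is `V = 1 - O`, where `O` is the part of `P' - P` that is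
off-diagonal with respect to `P`.  The first-order term `O` oscillates: since the two parts of the
spectrum are separated by a gap, the equation `X W - W X = O W` has a small off-diagonal solution
`X`, which turns the sum of the first-order terms into a telescoping sum in the interaction
picture, plus differences `X (n + 1) - X n`.  These are of second order by the same bounds for
Sylvester equations, which follow from enclosing one of the two separated arcs in a disc that stays
at a definite distance from the other.  When some step is so large compared with its gap that `V` is
not close to `1`, the error bound exceeds `2`, the trivial bound for the distance of two products of
contractions.
-/

noncomputable section

namespace DiscreteAdiabatic

section Blocks

variable {A : Type*} [Ring A] {p p' x : A}

/-- The off-diagonal part of `x` with respect to the decompositions `1 = p + (1 - p)` on the left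
and `1 = q + (1 - q)` on the right. -/
def offDiag (p q x : A) : A :=
  p * x * (1 - q) + (1 - p) * x * q

/-- The diagonal part of `x`, complementary to `offDiag`. -/
def onDiag (p q x : A) : A :=
  p * x * q + (1 - p) * x * (1 - q)

lemma offDiag_add_onDiag (p q x : A) : offDiag p q x + onDiag p q x = x := by
  unfold offDiag onDiag
  noncomm_ring

lemma onDiag_sub (p q x y : A) : onDiag p q (x - y) = onDiag p q x - onDiag p q y := by
  unfold onDiag
  noncomm_ring

lemma onDiag_eq_zero_of_offDiag_eq {q : A} (hx : offDiag p q x = x) : onDiag p q x = 0 := by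
  simpa [hx] using offDiag_add_onDiag p q x

lemma offDiag_one_sub (p q x : A) : offDiag (1 - p) (1 - q) x = offDiag p q x := by
  unfold offDiag
  rw [sub_sub_cancel, sub_sub_cancel, add_comm]

lemma offDiag_mul_of_commute {w : A} (h : Commute w p) :
    offDiag p p (x * w) = offDiag p p x * w := by
  have h' : w * (1 - p) = (1 - p) * w := ((Commute.one_right w).sub_right h).eq
  simp only [offDiag, add_mul, mul_assoc, h.eq, h']

lemma offDiag_one (hp : IsIdempotentElem p) :
    offDiag p' p 1 = -((p' - p) * (2 * p - 1)) := by
  unfold offDiag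
  noncomm_ring [hp.eq]

lemma mul_self_mul (hp : IsIdempotentElem p) (x : A) : p * (p * x) = p * x := by
  rw [← mul_assoc, hp.eq]

lemma onDiag_second_diff {p'' : A} (hp : IsIdempotentElem p) (hp' : IsIdempotentElem p')
    (hp'' : IsIdempotentElem p'') :
    onDiag p' p' ((p'' - p') - (p' - p)) =
      -((2 * p' - 1) * ((p'' - p') ^ 2 + (p' - p) ^ 2)) := by
  unfold onDiag
  noncomm_ring [hp.eq, hp'.eq, hp''.eq, mul_self_mul hp']

lemma eq_mul_add_mul_of_offDiag_eq (hp : IsIdempotentElem p) (hx : offDiag p p x = x) :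
    x = p * x + x * p := by
  have h : p * offDiag p p x + offDiag p p x * p = offDiag p p x := by
    unfold offDiag
    noncomm_ring [hp.eq, mul_self_mul hp]
  rw [hx] at h
  exact h.symm

lemma onDiag_of_offDiag_eq (hp : IsIdempotentElem p) (hp' : IsIdempotentElem p')
    (hx : offDiag p p x = x) :
    onDiag p' p' x = (2 * p' - 1) * ((p' - p) * x + x * (p' - p)) := by
  have h : (p' - p) * x + x * (p' - p) = p' * x + x * p' - x := by
    nth_rw 5 [eq_mul_add_mul_of_offDiag_eq hp hx]
    noncomm_ring
  rw [h, onDiag]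
  noncomm_ring [hp'.eq, mul_self_mul hp']

/-- The off-diagonal part of `S†`, where `S = p' p + (1 - p') (1 - p)` is the transfer from `p` to
`p'`. It is the first-order part of `V† - 1`, where `V` is the unitary of the polar decomposition
of `S`. -/
def offTransfer (p' p : A) : A :=
  offDiag p p (p * p' + (1 - p) * (1 - p'))

lemma offTransfer_eq (hp : IsIdempotentElem p) (hp' : IsIdempotentElem p') :
    offTransfer p' p = (2 * p - 1) * (p' - p) + (p' - p) ^ 2 := by
  unfold offTransfer offDiag
  noncomm_ring [hp.eq, hp'.eq, mul_self_mul hp]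

lemma offTransfer_eq_mul_offDiag (hp : IsIdempotentElem p) (hp' : IsIdempotentElem p') :
    offTransfer p' p = (2 * p - 1) * offDiag p p (p' - p) := by
  rw [offTransfer_eq hp hp', offDiag]
  noncomm_ring [hp.eq, hp'.eq, mul_self_mul hp]

end Blocks

section CStar

variable {A : Type*} [CStarAlgebra A] {p q : A}

lemma norm_mul_mul_le_of_isStarProjection (hp : IsStarProjection p) (hq : IsStarProjection q)
    (x : A) : ‖p * x * q‖ ≤ ‖x‖ :=
  calc ‖p * x * q‖ ≤ ‖p‖ * ‖x‖ * ‖q‖ := norm_mul₃_le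
    _ ≤ 1 * ‖x‖ * 1 := by gcongr <;> [exact hp.norm_le; exact hq.norm_le]
    _ = ‖x‖ := by ring

lemma star_mul_self_mul_le [PartialOrder A] [StarOrderedRing A] (hq : IsStarProjection q) {m : ℝ}
    {x : A} (hx : ‖x * q‖ ≤ m) : star (x * q) * (x * q) ≤ m ^ 2 • q := by
  have h : star (x * q) * (x * q) = star q * (star (x * q) * (x * q)) * q := by
    simp only [star_mul, hq.isSelfAdjoint.star_eq, mul_assoc, hq.isIdempotentElem.eq,
      mul_self_mul hq.isIdempotentElem]
  have hn : ‖star (x * q) * (x * q)‖ ≤ m ^ 2 := by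
    rw [CStarRing.norm_star_mul_self, ← sq]
    gcongr
  calc star (x * q) * (x * q) = star q * (star (x * q) * (x * q)) * q := h
    _ ≤ ‖star (x * q) * (x * q)‖ • (star q * q) :=
      CStarAlgebra.star_left_conjugate_le_norm_smul (.star_mul_self _)
    _ = ‖star (x * q) * (x * q)‖ • q := by rw [hq.isSelfAdjoint.star_eq, hq.isIdempotentElem.eq]
    _ ≤ m ^ 2 • q := smul_le_smul_of_nonneg_right hn hq.nonneg

/-- The two corners have orthogonal ranges and orthogonal supports, so the norm of their sum is the
larger of their norms. -/
lemma norm_corner_add_corner_le (hp : IsStarProjection p) (hq : IsStarProjection q) {x y : A}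
    {m : ℝ} (hx : ‖p * x * (1 - q)‖ ≤ m) (hy : ‖(1 - p) * y * q‖ ≤ m) :
    ‖p * x * (1 - q) + (1 - p) * y * q‖ ≤ m := by
  let _ := CStarAlgebra.spectralOrder A
  have _ := CStarAlgebra.spectralOrderedRing A
  have hm : 0 ≤ m := (norm_nonneg _).trans hx
  set s := p * x * (1 - q) with hs
  set t := (1 - p) * y * q with ht
  have hst : star s * t = 0 := by
    have : star s * t = (1 - q) * star x * (p * (1 - p)) * y * q := by
      simp only [hs, ht, star_mul, hp.isSelfAdjoint.star_eq, hq.one_sub.isSelfAdjoint.star_eq,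
        mul_assoc]
    rw [this, hp.mul_one_sub_self]
    noncomm_ring
  have hts : star t * s = 0 := by simpa using congrArg star hst
  have hsum : star (s + t) * (s + t) = star s * s + star t * t := by
    rw [star_add, add_mul, mul_add, mul_add, hst, hts, add_zero, zero_add]
  have hle : star (s + t) * (s + t) ≤ algebraMap ℝ A (m ^ 2) :=
    calc star (s + t) * (s + t) = star s * s + star t * t := hsum
      _ ≤ m ^ 2 • (1 - q) + m ^ 2 • q :=
        add_le_add (star_mul_self_mul_le hq.one_sub hx) (star_mul_self_mul_le hq hy)
      _ = algebraMap ℝ A (m ^ 2) := by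
        rw [← smul_add, sub_add_cancel, Algebra.algebraMap_eq_smul_one]
  have hnorm : ‖star (s + t) * (s + t)‖ ≤ m ^ 2 :=
    (CStarAlgebra.norm_le_iff_le_algebraMap _ (sq_nonneg m) (star_mul_self_nonneg _)).2 hle
  rw [CStarRing.norm_star_mul_self, ← sq] at hnorm
  exact (sq_le_sq₀ (norm_nonneg _) hm).1 hnorm

lemma norm_offDiag_le (hp : IsStarProjection p) (hq : IsStarProjection q) (x : A) :
    ‖offDiag p q x‖ ≤ ‖x‖ :=
  norm_corner_add_corner_le hp hq (norm_mul_mul_le_of_isStarProjection hp hq.one_sub x)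
    (norm_mul_mul_le_of_isStarProjection hp.one_sub hq x)

lemma norm_le_norm_offDiag_add_norm_onDiag (p q x : A) :
    ‖x‖ ≤ ‖offDiag p q x‖ + ‖onDiag p q x‖ :=
  calc ‖x‖ = ‖offDiag p q x + onDiag p q x‖ := by rw [offDiag_add_onDiag]
    _ ≤ _ := norm_add_le _ _

lemma norm_two_mul_sub_one_mul (hp : IsStarProjection p) (x : A) : ‖(2 * p - 1) * x‖ = ‖x‖ :=
  CStarRing.norm_mem_unitary_mul x hp.two_mul_sub_one_mem_unitary

lemma norm_mul_two_mul_sub_one (hp : IsStarProjection p) (x : A) : ‖x * (2 * p - 1)‖ = ‖x‖ :=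
  CStarRing.norm_mul_mem_unitary x hp.two_mul_sub_one_mem_unitary

lemma norm_commutator_le (hp : IsStarProjection p) (x : A) : ‖x * p - p * x‖ ≤ ‖x‖ := by
  have h : 2 * ‖x * p - p * x‖ ≤ ‖x‖ + ‖x‖ :=
    calc 2 * ‖x * p - p * x‖ = ‖(2 : ℝ) • (x * p - p * x)‖ := by rw [norm_smul, Real.norm_two]
      _ = ‖x * (2 * p - 1) - (2 * p - 1) * x‖ := by rw [two_smul]; noncomm_ring
      _ ≤ ‖x‖ + ‖x‖ := (norm_sub_le _ _).trans_eq <| by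
        rw [norm_mul_two_mul_sub_one hp, norm_two_mul_sub_one_mul hp]
  linarith

end CStar

section Sylvester

lemma exists_eq_add_mul_mul {A : Type*} [NormedRing A] [CompleteSpace A] (y : A) {b g : A}
    (h : ‖b‖ * ‖g‖ < 1) : ∃ t, t = y + b * t * g := by
  have hf : ContractingWith (‖b‖₊ * ‖g‖₊) fun t => y + b * t * g := by
    refine ⟨by exact_mod_cast h, LipschitzWith.of_dist_le_mul fun t s => ?_⟩
    calc dist (y + b * t * g) (y + b * s * g) = ‖b * (t - s) * g‖ := by
          rw [dist_add_left, dist_eq_norm, mul_sub, sub_mul]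
      _ ≤ ‖b‖ * ‖t - s‖ * ‖g‖ := norm_mul₃_le
      _ = (‖b‖₊ * ‖g‖₊ : NNReal) * dist t s := by
          rw [dist_eq_norm, NNReal.coe_mul, coe_nnnorm, coe_nnnorm]
          ring
  exact ⟨_, hf.fixedPoint_isFixedPt.symm⟩

variable {A : Type*} [CStarAlgebra A] {w w₁ w₂ p p₁ p₂ : A} {z : ℂ} {r ρ : ℝ}

/-- The Sylvester operator `x ↦ x w₂ - w₁ x` is bounded below by `δ` on off-diagonal elements. -/
def SylvesterBound (w₁ p₁ w₂ p₂ : A) (δ : ℝ) : Prop :=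
  ∀ x, δ * ‖offDiag p₁ p₂ x‖ ≤ ‖x * w₂ - w₁ * x‖

/-- The commutator with `w` maps onto the off-diagonal elements. -/
def SylvesterSolvable (w p : A) : Prop :=
  ∀ y, ∃ x, offDiag p p x = x ∧ x * w - w * x = offDiag p p y

lemma SylvesterBound.mono {δ δ' : ℝ} (h : SylvesterBound w₁ p₁ w₂ p₂ δ) (hδ : δ' ≤ δ) :
    SylvesterBound w₁ p₁ w₂ p₂ δ' :=
  fun x => (mul_le_mul_of_nonneg_right hδ (norm_nonneg _)).trans (h x)

lemma sylvesterBound_one_sub_iff {δ : ℝ} :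
    SylvesterBound w₁ (1 - p₁) w₂ (1 - p₂) δ ↔ SylvesterBound w₁ p₁ w₂ p₂ δ := by
  simp only [SylvesterBound, offDiag_one_sub]

lemma sylvesterSolvable_one_sub_iff : SylvesterSolvable w (1 - p) ↔ SylvesterSolvable w p := by
  simp only [SylvesterSolvable, offDiag_one_sub]

/-- A circle of centre `z` separates the part of `w` on the range of `p`, which lies inside radius
`r`, from the part of `w` on the range of `1 - p`, which lies outside radius `ρ`. -/
structure DiscSeparated (w p : A) (z : ℂ) (r ρ : ℝ) : Prop where
  isStarProjection : IsStarProjection p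
  commute : Commute w p
  norm_inner_le : ‖(w - algebraMap ℂ A z) * p‖ ≤ r
  exists_outer : ∃ g, (w - algebraMap ℂ A z) * g = 1 - p ∧ g * (w - algebraMap ℂ A z) = 1 - p ∧
    ρ * ‖g‖ ≤ 1

lemma sylvester_sub_algebraMap (x w₁ w₂ : A) (z : ℂ) :
    x * (w₂ - algebraMap ℂ A z) - (w₁ - algebraMap ℂ A z) * x = x * w₂ - w₁ * x := by
  rw [mul_sub, sub_mul, Algebra.commutes z x]
  abel

namespace DiscSeparated

lemma commute_sub (h : DiscSeparated w p z r ρ) : Commute (w - algebraMap ℂ A z) p :=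
  h.commute.sub_left (Algebra.commute_algebraMap_left z p)

lemma adjoint (h : DiscSeparated w p z r ρ) : DiscSeparated (star w) p (star z) r ρ := by
  have hp := h.isStarProjection.isSelfAdjoint.star_eq
  have hw : star (w - algebraMap ℂ A z) = star w - algebraMap ℂ A (star z) := by
    rw [star_sub, algebraMap_star_comm]
  obtain ⟨g, hwg, hgw, hg⟩ := h.exists_outer
  refine ⟨h.isStarProjection, ?_, ?_, star g, ?_, ?_, by rwa [norm_star]⟩
  · simpa only [hp] using h.commute.star_star
  · rw [← hw]
    nth_rw 1 [← hp]
    rw [← star_mul, norm_star, ← h.commute_sub.eq]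
    exact h.norm_inner_le
  · rw [← hw, ← star_mul, hgw, h.isStarProjection.one_sub.isSelfAdjoint.star_eq]
  · rw [← hw, ← star_mul, hwg, h.isStarProjection.one_sub.isSelfAdjoint.star_eq]

lemma corner_mul_sub (h₁ : DiscSeparated w₁ p₁ z r ρ) (h₂ : DiscSeparated w₂ p₂ z r ρ) (x : A) :
    p₁ * x * (1 - p₂) * (w₂ - algebraMap ℂ A z) = p₁ * (x * w₂ - w₁ * x) * (1 - p₂) +
      (w₁ - algebraMap ℂ A z) * p₁ * (p₁ * x * (1 - p₂)) := by
  have hp₁ := h₁.commute_sub.eq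
  have hq₂ := ((Commute.one_right _).sub_right h₂.commute_sub).eq
  rw [← sylvester_sub_algebraMap x w₁ w₂ z]
  set m₁ := w₁ - algebraMap ℂ A z
  set m₂ := w₂ - algebraMap ℂ A z
  calc p₁ * x * (1 - p₂) * m₂ = p₁ * (x * m₂ - m₁ * x) * (1 - p₂) + p₁ * m₁ * x * (1 - p₂) := by
        simp only [mul_assoc, ← hq₂, mul_sub p₁, sub_mul _ _ (1 - p₂)]
        abel
    _ = _ := by
        rw [← hp₁]
        simp only [mul_assoc, mul_self_mul h₁.isStarProjection.isIdempotentElem]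

lemma norm_corner_le (h₁ : DiscSeparated w₁ p₁ z r ρ) (h₂ : DiscSeparated w₂ p₂ z r ρ)
    (hρ : 0 ≤ ρ) (x : A) : (ρ - r) * ‖p₁ * x * (1 - p₂)‖ ≤ ‖x * w₂ - w₁ * x‖ := by
  obtain ⟨g, hwg, -, hg⟩ := h₂.exists_outer
  have hp₁ := h₁.isStarProjection
  have hq₂ := h₂.isStarProjection.one_sub
  set y := x * w₂ - w₁ * x
  set t := p₁ * x * (1 - p₂)
  have htg : t = (p₁ * y * (1 - p₂) + (w₁ - algebraMap ℂ A z) * p₁ * t) * g := by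
    rw [← h₁.corner_mul_sub h₂, mul_assoc _ _ g, hwg, mul_assoc _ (1 - p₂),
      hq₂.isIdempotentElem.eq]
  have hr : 0 ≤ r := (norm_nonneg _).trans h₁.norm_inner_le
  have hnorm : ‖t‖ ≤ (‖y‖ + r * ‖t‖) * ‖g‖ :=
    calc ‖t‖ = ‖(p₁ * y * (1 - p₂) + (w₁ - algebraMap ℂ A z) * p₁ * t) * g‖ := congrArg norm htg
      _ ≤ (‖p₁ * y * (1 - p₂)‖ + ‖(w₁ - algebraMap ℂ A z) * p₁‖ * ‖t‖) * ‖g‖ := by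
        refine (norm_mul_le _ _).trans (mul_le_mul_of_nonneg_right ?_ (norm_nonneg _))
        exact (norm_add_le _ _).trans (add_le_add_right (norm_mul_le _ _) _)
      _ ≤ (‖y‖ + r * ‖t‖) * ‖g‖ := by
        gcongr
        · exact norm_mul_mul_le_of_isStarProjection hp₁ hq₂ y
        · exact h₁.norm_inner_le
  have : ρ * ‖t‖ ≤ ‖y‖ + r * ‖t‖ :=
    calc ρ * ‖t‖ ≤ ρ * ((‖y‖ + r * ‖t‖) * ‖g‖) := by gcongr
      _ = (‖y‖ + r * ‖t‖) * (ρ * ‖g‖) := by ring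
      _ ≤ ‖y‖ + r * ‖t‖ := mul_le_of_le_one_right (by positivity) hg
  linarith

lemma sylvesterBound (h₁ : DiscSeparated w₁ p₁ z r ρ) (h₂ : DiscSeparated w₂ p₂ z r ρ)
    (hρ : r < ρ) : SylvesterBound w₁ p₁ w₂ p₂ (ρ - r) := by
  intro x
  have hρ0 : 0 ≤ ρ := ((norm_nonneg _).trans h₁.norm_inner_le).trans hρ.le
  have hδ : 0 < ρ - r := sub_pos.2 hρ
  rw [← le_div_iff₀' hδ]
  refine norm_corner_add_corner_le h₁.isStarProjection h₂.isStarProjection ?_ ?_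
  · rw [le_div_iff₀' hδ]
    exact h₁.norm_corner_le h₂ hρ0 x
  · rw [le_div_iff₀' hδ]
    have hl : (1 - p₁) * x * p₂ = star (p₂ * star x * (1 - p₁)) := by
      simp only [star_mul, star_star, h₂.isStarProjection.isSelfAdjoint.star_eq,
        h₁.isStarProjection.one_sub.isSelfAdjoint.star_eq, mul_assoc]
    have hr : x * w₂ - w₁ * x =
        -star (star x * star w₁ - star w₂ * star x) := by
      simp only [star_sub, star_mul, star_star, neg_sub]
    rw [hl, hr, norm_star, norm_neg, norm_star]
    exact h₂.adjoint.norm_corner_le h₁.adjoint hρ0 (star x)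

lemma exists_corner_eq (h : DiscSeparated w p z r ρ) (hρ : r < ρ) (y : A) :
    ∃ x, p * (x * w - w * x) * (1 - p) = p * y * (1 - p) := by
  obtain ⟨g, -, hgw, hg⟩ := h.exists_outer
  set m := w - algebraMap ℂ A z with hm
  have hcontr : ‖m * p‖ * ‖g‖ < 1 := by
    have hr : ‖m * p‖ * ‖g‖ ≤ r * ‖g‖ := by
      gcongr
      exact h.norm_inner_le
    rcases (norm_nonneg g).eq_or_lt with h0 | h0
    · simp [← h0]
    · nlinarith
  obtain ⟨t, ht⟩ := exists_eq_add_mul_mul (p * y * (1 - p) * g) hcontr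
  refine ⟨t, ?_⟩
  have hpm : m * p = p * m := h.commute_sub.eq
  have hqq := h.isStarProjection.one_sub.isIdempotentElem.eq
  have htm : t * m = p * y * (1 - p) + m * p * t * (1 - p) :=
    calc t * m = (p * y * (1 - p) * g + m * p * t * g) * m := congrArg (· * m) ht
      _ = p * y * ((1 - p) * (1 - p)) + m * p * t * (1 - p) := by
        rw [← hgw]; noncomm_ring [hgw, hqq]
      _ = _ := by rw [hqq]
  rw [← sylvester_sub_algebraMap t w w z, ← hm, htm, hpm]
  clear_value m
  noncomm_ring [mul_self_mul h.isStarProjection.isIdempotentElem,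
    h.isStarProjection.isIdempotentElem.eq]

lemma sylvesterSolvable (h : DiscSeparated w p z r ρ) (hρ : r < ρ) : SylvesterSolvable w p := by
  intro y
  obtain ⟨t, ht⟩ := h.exists_corner_eq hρ y
  obtain ⟨s, hs⟩ := h.adjoint.exists_corner_eq hρ (-star y)
  have hp := h.isStarProjection
  have hs' : (1 - p) * (star s * w - w * star s) * p = (1 - p) * y * p := by
    have := congrArg star hs
    simp only [star_mul, star_sub, star_neg, star_star, star_one, hp.isSelfAdjoint.star_eq] at this
    rw [← neg_inj, mul_assoc, mul_assoc, ← mul_neg, ← neg_mul, neg_sub, this]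
    noncomm_ring
  have hwp := h.commute.eq
  refine ⟨p * t * (1 - p) + (1 - p) * star s * p, ?_, ?_⟩
  · unfold offDiag
    noncomm_ring [hp.isIdempotentElem.eq, mul_self_mul hp.isIdempotentElem]
  · rw [offDiag, ← ht, ← hs']
    have hpw : ∀ x, w * (p * x) = p * (w * x) := fun x => by rw [← mul_assoc, hwp, mul_assoc]
    noncomm_ring [hwp, hpw]

end DiscSeparated

end Sylvester

section Corrector

variable {A : Type*}

lemma commutator_second_diff [Ring A] {w w' w'' p p' p'' : A} (h : Commute w p)
    (h' : Commute w' p') (h'' : Commute w'' p'') :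
    ((p'' - p') - (p' - p)) * w' - w' * ((p'' - p') - (p' - p)) =
      (((w'' - w') - (w' - w)) * p' - p' * ((w'' - w') - (w' - w)))
      + ((w'' - w') * (p'' - p') - (p'' - p') * (w'' - w'))
      + ((w' - w) * (p' - p) - (p' - p) * (w' - w)) := by
  noncomm_ring [h.eq, h'.eq, h''.eq]

lemma norm_mul_sub_mul_le [NormedRing A] (x y : A) : ‖x * y - y * x‖ ≤ 2 * (‖x‖ * ‖y‖) :=
  calc ‖x * y - y * x‖ ≤ ‖x * y‖ + ‖y * x‖ := norm_sub_le _ _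
    _ ≤ ‖x‖ * ‖y‖ + ‖y‖ * ‖x‖ := add_le_add (norm_mul_le _ _) (norm_mul_le _ _)
    _ = 2 * (‖x‖ * ‖y‖) := by ring

variable [CStarAlgebra A] {w w' w'' p p' p'' o o' x x' : A} {δ : ℝ}

lemma SylvesterBound.norm_proj_sub_le (h : SylvesterBound w' p' w p δ) (hp : IsStarProjection p) :
    δ * ‖p' - p‖ ≤ ‖w' - w‖ := by
  have h1 := h 1
  rwa [offDiag_one hp.isIdempotentElem, norm_neg, norm_mul_two_mul_sub_one hp, one_mul, mul_one,
    norm_sub_rev w] at h1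

lemma norm_onDiag_second_diff_le (hp : IsStarProjection p) (hp' : IsStarProjection p')
    (hp'' : IsStarProjection p'') :
    ‖onDiag p' p' ((p'' - p') - (p' - p))‖ ≤ ‖p'' - p'‖ ^ 2 + ‖p' - p‖ ^ 2 := by
  rw [onDiag_second_diff hp.isIdempotentElem hp'.isIdempotentElem hp''.isIdempotentElem, norm_neg,
    norm_two_mul_sub_one_mul hp']
  exact (norm_add_le _ _).trans
    (add_le_add (norm_pow_le' _ two_pos) (norm_pow_le' _ two_pos))

lemma SylvesterBound.norm_proj_second_diff_le (h : SylvesterBound w' p' w' p' δ) (hδ : 0 ≤ δ)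
    (hp : IsStarProjection p) (hp' : IsStarProjection p') (hp'' : IsStarProjection p'')
    (hw : Commute w p) (hw' : Commute w' p') (hw'' : Commute w'' p'') :
    δ * ‖(p'' - p') - (p' - p)‖ ≤ ‖(w'' - w') - (w' - w)‖ + 2 * (‖w'' - w'‖ * ‖p'' - p'‖)
      + 2 * (‖w' - w‖ * ‖p' - p‖) + δ * (‖p'' - p'‖ ^ 2 + ‖p' - p‖ ^ 2) := by
  have hoff := h ((p'' - p') - (p' - p))
  rw [commutator_second_diff hw hw' hw''] at hoff
  calc δ * ‖(p'' - p') - (p' - p)‖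
      ≤ δ * ‖offDiag p' p' ((p'' - p') - (p' - p))‖
        + δ * ‖onDiag p' p' ((p'' - p') - (p' - p))‖ := by
        rw [← mul_add]
        gcongr
        exact norm_le_norm_offDiag_add_norm_onDiag ..
    _ ≤ _ := by
        gcongr
        · refine hoff.trans (norm_add₃_le.trans ?_)
          gcongr
          · exact norm_commutator_le hp' _
          · exact norm_mul_sub_mul_le _ _
          · exact norm_mul_sub_mul_le _ _
        · exact norm_onDiag_second_diff_le hp hp' hp''

lemma norm_offTransfer_le (hp : IsStarProjection p) (hp' : IsStarProjection p') :
    ‖offTransfer p' p‖ ≤ ‖p' - p‖ := by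
  rw [offTransfer_eq_mul_offDiag hp.isIdempotentElem hp'.isIdempotentElem,
    norm_two_mul_sub_one_mul hp]
  exact norm_offDiag_le hp hp _

lemma norm_offTransfer_sub_le (hp : IsStarProjection p) (hp' : IsStarProjection p')
    (hp'' : IsStarProjection p'') :
    ‖offTransfer p'' p' - offTransfer p' p‖ ≤
      ‖(p'' - p') - (p' - p)‖ + ‖p'' - p'‖ ^ 2 + ‖p' - p‖ ^ 2 := by
  have h : offTransfer p'' p' - offTransfer p' p =
      (2 * p' - 1) * ((p'' - p') - (p' - p)) + (p'' - p') ^ 2 + (p' - p) ^ 2 := by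
    rw [offTransfer_eq hp.isIdempotentElem hp'.isIdempotentElem,
      offTransfer_eq hp'.isIdempotentElem hp''.isIdempotentElem]
    noncomm_ring
  rw [h, ← norm_two_mul_sub_one_mul hp' ((p'' - p') - (p' - p))]
  refine norm_add₃_le.trans ?_
  gcongr <;> exact norm_pow_le' _ two_pos

/-- `x` is an off-diagonal solution of `[x, w] = o w`: conjugating the step `w` by `1 + x` removes
the first-order part `o` of the transfer unitary. -/
structure IsCorrector (w p o x : A) : Prop where
  offDiag_eq : offDiag p p x = x
  commutator_eq : x * w - w * x = o * w

lemma SylvesterSolvable.exists_isCorrector (h : SylvesterSolvable w p) (hw : Commute w p)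
    (p' : A) : ∃ x, IsCorrector w p (offTransfer p' p) x := by
  obtain ⟨x, hx, hxw⟩ := h ((p * p' + (1 - p) * (1 - p')) * w)
  exact ⟨x, hx, by rw [hxw, offDiag_mul_of_commute hw, offTransfer]⟩

lemma IsCorrector.norm_le (hx : IsCorrector w p o x) (hw : w ∈ unitary A)
    (h : SylvesterBound w p w p δ) : δ * ‖x‖ ≤ ‖o‖ := by
  simpa only [hx.offDiag_eq, hx.commutator_eq, CStarRing.norm_mul_mem_unitary _ hw] using h x

lemma IsCorrector.norm_onDiag_sub_le (hx : IsCorrector w p o x) (hx' : IsCorrector w' p' o' x')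
    (hp : IsStarProjection p) (hp' : IsStarProjection p') :
    ‖onDiag p' p' (x' - x)‖ ≤ 2 * (‖p' - p‖ * ‖x‖) := by
  rw [onDiag_sub, onDiag_eq_zero_of_offDiag_eq hx'.offDiag_eq, zero_sub, norm_neg,
    onDiag_of_offDiag_eq hp.isIdempotentElem hp'.isIdempotentElem hx.offDiag_eq,
    norm_two_mul_sub_one_mul hp']
  calc ‖(p' - p) * x + x * (p' - p)‖ ≤ ‖p' - p‖ * ‖x‖ + ‖x‖ * ‖p' - p‖ :=
        (norm_add_le _ _).trans (add_le_add (norm_mul_le _ _) (norm_mul_le _ _))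
    _ = 2 * (‖p' - p‖ * ‖x‖) := by ring

lemma IsCorrector.norm_commutator_sub_le (hx : IsCorrector w p o x)
    (hx' : IsCorrector w' p' o' x') (hw' : w' ∈ unitary A) :
    ‖(x' - x) * w' - w' * (x' - x)‖ ≤
      ‖o' - o‖ + ‖o‖ * ‖w' - w‖ + 2 * (‖w' - w‖ * ‖x‖) := by
  have h : (x' - x) * w' - w' * (x' - x) =
      (o' - o) * w' + o * (w' - w) + ((w' - w) * x - x * (w' - w)) := by
    have : (x' - x) * w' - w' * (x' - x) =
        (x' * w' - w' * x') - (x * w - w * x) + ((w' - w) * x - x * (w' - w)) := by noncomm_ring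
    rw [this, hx.commutator_eq, hx'.commutator_eq]
    noncomm_ring
  rw [h, ← CStarRing.norm_mul_mem_unitary (o' - o) hw']
  refine norm_add₃_le.trans ?_
  gcongr
  · exact norm_mul_le _ _
  · exact norm_mul_sub_mul_le _ _

lemma IsCorrector.norm_sub_le (hx : IsCorrector w p o x) (hx' : IsCorrector w' p' o' x')
    (hδ : 0 ≤ δ) (hp : IsStarProjection p) (hp' : IsStarProjection p') (hw' : w' ∈ unitary A)
    (h : SylvesterBound w' p' w' p' δ) :
    δ * ‖x' - x‖ ≤ ‖o' - o‖ + ‖o‖ * ‖w' - w‖ + 2 * (‖w' - w‖ * ‖x‖)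
      + δ * (2 * (‖p' - p‖ * ‖x‖)) :=
  calc δ * ‖x' - x‖
      ≤ δ * ‖offDiag p' p' (x' - x)‖ + δ * ‖onDiag p' p' (x' - x)‖ := by
        rw [← mul_add]
        gcongr
        exact norm_le_norm_offDiag_add_norm_onDiag ..
    _ ≤ _ := by
        gcongr
        · exact (h (x' - x)).trans (hx.norm_commutator_sub_le hx' hw')
        · exact hx.norm_onDiag_sub_le hx' hp hp'

end Corrector

section Transfer

lemma norm_le_norm_one_add_mul {A : Type*} [CStarAlgebra A] [PartialOrder A] [StarOrderedRing A]
    {v : A} (hv : 0 ≤ v) (x : A) : ‖x‖ ≤ ‖(1 + v) * x‖ := by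
  have hvs : star v = v := hv.isSelfAdjoint.star_eq
  have hsq : 1 ≤ star (1 + v) * (1 + v) :=
    calc (1 : A) ≤ 1 + (v + v + star v * v) :=
          le_add_of_nonneg_right (add_nonneg (add_nonneg hv hv) (star_mul_self_nonneg v))
      _ = star (1 + v) * (1 + v) := by rw [star_add, star_one, hvs]; noncomm_ring
  have hle : star x * x ≤ star ((1 + v) * x) * ((1 + v) * x) := by
    simpa only [star_mul, mul_assoc, mul_one, one_mul] using star_left_conjugate_le_conjugate hsq x
  have hnorm := CStarAlgebra.norm_le_norm_of_nonneg_of_le (star_mul_self_nonneg x) hle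
  rw [CStarRing.norm_star_mul_self, CStarRing.norm_star_mul_self] at hnorm
  exact (mul_self_le_mul_self_iff (norm_nonneg _) (norm_nonneg _)).2 hnorm

lemma norm_le_one_of_mul_star_eq_one {A : Type*} [CStarAlgebra A] {v : A}
    (hv : v * star v = 1) : ‖v‖ ≤ 1 := by
  rcases subsingleton_or_nontrivial A with _ | _
  · rw [Subsingleton.elim v 0, norm_zero]
    exact zero_le_one
  · have h := CStarRing.norm_self_mul_star (x := v)
    rw [hv, norm_one] at h
    nlinarith

variable {H : Type*} [NormedAddCommGroup H] [InnerProductSpace ℂ H] [CompleteSpace H]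
  {P P' : H →L[ℂ] H}

lemma star_transferS (hP : IsStarProjection P) (hP' : IsStarProjection P') :
    star (transferS P' P) = transferS P P' := by
  simp [transferS, hP.isSelfAdjoint.star_eq, hP'.isSelfAdjoint.star_eq]

lemma transferS_sub_one (hP : IsStarProjection P) :
    transferS P P' - 1 = (2 * P - 1) * (P' - P) := by
  unfold transferS
  noncomm_ring [hP.isIdempotentElem.eq]

lemma transferS_mul_transferS (hP : IsStarProjection P) (hP' : IsStarProjection P') :
    transferS P' P * transferS P P' = 1 - (P' - P) ^ 2 := by
  unfold transferS
  noncomm_ring [hP.isIdempotentElem.eq, hP'.isIdempotentElem.eq, mul_self_mul hP.isIdempotentElem]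

lemma star_transferAbs : star (transferAbs P' P) = transferAbs P' P :=
  (CFC.sqrt_nonneg _).isSelfAdjoint.star_eq

lemma transferAbs_mul_self : transferAbs P' P * transferAbs P' P =
    transferS P' P * star (transferS P' P) :=
  CFC.sqrt_mul_sqrt_self _ (mul_star_self_nonneg _)

lemma transferAbs_mul_self_eq_one_sub (hP : IsStarProjection P) (hP' : IsStarProjection P') :
    transferAbs P' P * transferAbs P' P = 1 - (P' - P) ^ 2 := by
  rw [transferAbs_mul_self, star_transferS hP hP', transferS_mul_transferS hP hP']

lemma isUnit_one_sub_sq {A : Type*} [NormedRing A] [CompleteSpace A] {d : A} (hd : ‖d‖ < 1) :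
    IsUnit (1 - d ^ 2) :=
  isUnit_one_sub_of_norm_lt_one <|
    (norm_pow_le' d two_pos).trans_lt (pow_lt_one₀ (norm_nonneg d) hd two_ne_zero)

lemma isUnit_transferAbs (hP : IsStarProjection P) (hP' : IsStarProjection P')
    (hd : ‖P' - P‖ < 1) : IsUnit (transferAbs P' P) := by
  have h := isUnit_one_sub_sq hd
  rw [← transferAbs_mul_self_eq_one_sub hP hP'] at h
  exact ((Commute.refl (transferAbs P' P)).isUnit_mul_iff.1 h).1

lemma transferAbs_mul_transferV (h : IsUnit (transferAbs P' P)) :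
    transferAbs P' P * transferV P' P = transferS P' P := by
  rw [transferV, ← mul_assoc, Ring.mul_inverse_cancel _ h, one_mul]

lemma transferV_mul_star (h : IsUnit (transferAbs P' P)) :
    transferV P' P * star (transferV P' P) = 1 := by
  refine h.mul_left_cancel (h.mul_right_cancel ?_)
  calc transferAbs P' P * (transferV P' P * star (transferV P' P)) * transferAbs P' P
      = transferAbs P' P * transferV P' P * star (transferAbs P' P * transferV P' P) := by
        rw [star_mul, star_transferAbs]
        simp only [mul_assoc]
    _ = transferAbs P' P * 1 * transferAbs P' P := by
        rw [transferAbs_mul_transferV h, ← transferAbs_mul_self, mul_one]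

lemma norm_transferV_le (h : IsUnit (transferAbs P' P)) : ‖transferV P' P‖ ≤ 1 :=
  norm_le_one_of_mul_star_eq_one (transferV_mul_star h)

lemma isUnit_transferS (hP : IsStarProjection P) (hP' : IsStarProjection P')
    (hd : ‖P' - P‖ < 1) : IsUnit (transferS P' P) := by
  have hcomm : Commute (transferS P' P) (transferS P P') := by
    rw [Commute, SemiconjBy, transferS_mul_transferS hP hP', transferS_mul_transferS hP' hP]
    noncomm_ring
  have h := isUnit_one_sub_sq hd
  rw [← transferS_mul_transferS hP hP'] at h
  exact (hcomm.isUnit_mul_iff.1 h).1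

lemma transferV_mem_unitary (hP : IsStarProjection P) (hP' : IsStarProjection P')
    (hd : ‖P' - P‖ < 1) : transferV P' P ∈ unitary (H →L[ℂ] H) := by
  have hv := isUnit_transferAbs hP hP' hd
  have hV : IsUnit (transferV P' P) :=
    (isUnit_ringInverse.2 hv).mul (isUnit_transferS hP hP' hd)
  refine Unitary.mem_iff.2 ⟨hV.mul_left_cancel ?_, transferV_mul_star hv⟩
  rw [← mul_assoc, transferV_mul_star hv, one_mul, mul_one]

lemma norm_one_sub_transferAbs_le (hP : IsStarProjection P) (hP' : IsStarProjection P') :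
    ‖1 - transferAbs P' P‖ ≤ ‖P' - P‖ ^ 2 :=
  calc ‖1 - transferAbs P' P‖ ≤ ‖(1 + transferAbs P' P) * (1 - transferAbs P' P)‖ :=
        norm_le_norm_one_add_mul (CFC.sqrt_nonneg _) _
    _ = ‖(P' - P) ^ 2‖ := by
        congr 1
        rw [← sub_sub_cancel 1 ((P' - P) ^ 2), ← transferAbs_mul_self_eq_one_sub hP hP']
        noncomm_ring
    _ ≤ ‖P' - P‖ ^ 2 := norm_pow_le' _ two_pos

lemma star_transferV_sub_one (hP : IsStarProjection P) (hP' : IsStarProjection P')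
    (h : IsUnit (transferAbs P' P)) :
    star (transferV P' P) - 1 = (2 * P - 1) * (P' - P)
      + star (transferV P' P) * (1 - transferAbs P' P) := by
  rw [← transferS_sub_one hP, ← star_transferS hP hP', ← transferAbs_mul_transferV h, star_mul,
    star_transferAbs]
  noncomm_ring

lemma norm_star_transferV_mul_one_sub_le (hP : IsStarProjection P) (hP' : IsStarProjection P')
    (hd : ‖P' - P‖ < 1) :
    ‖star (transferV P' P) * (1 - transferAbs P' P)‖ ≤ ‖P' - P‖ ^ 2 := by
  have hV := Unitary.star_mem (transferV_mem_unitary hP hP' hd)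
  have hv := norm_one_sub_transferAbs_le hP hP'
  generalize star (transferV P' P) = V at *
  generalize transferAbs P' P = v at *
  rwa [CStarRing.norm_mem_unitary_mul _ hV]

lemma norm_star_transferV_sub_one_le (hP : IsStarProjection P) (hP' : IsStarProjection P')
    (hd : ‖P' - P‖ < 1) : ‖star (transferV P' P) - 1‖ ≤ ‖P' - P‖ + ‖P' - P‖ ^ 2 := by
  rw [star_transferV_sub_one hP hP' (isUnit_transferAbs hP hP' hd)]
  refine (norm_add_le _ _).trans (add_le_add (norm_two_mul_sub_one_mul hP _).le ?_)
  exact norm_star_transferV_mul_one_sub_le hP hP' hd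

lemma norm_star_transferV_sub_one_sub_le (hP : IsStarProjection P) (hP' : IsStarProjection P')
    (hd : ‖P' - P‖ < 1) :
    ‖star (transferV P' P) - 1 - offTransfer P' P‖ ≤ 2 * ‖P' - P‖ ^ 2 := by
  rw [star_transferV_sub_one hP hP' (isUnit_transferAbs hP hP' hd),
    offTransfer_eq hP.isIdempotentElem hP'.isIdempotentElem, add_sub_add_left_eq_sub, two_mul]
  exact (norm_sub_le _ _).trans
    (add_le_add (norm_star_transferV_mul_one_sub_le hP hP' hd) (norm_pow_le' _ two_pos))

end Transfer

section Evolution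

/-- Here `G n x` is to be thought of as `x` seen in a frame that moves with `n`. -/
lemma norm_sum_sub_le_of_norm_le {E F : Type*} [SeminormedAddCommGroup E]
    [SeminormedAddCommGroup F] (G : ℕ → E →+ F) (x : ℕ → E) {M : ℕ}
    (hG : ∀ n ≤ M + 1, ∀ y, ‖G n y‖ ≤ ‖y‖) :
    ‖∑ n ∈ Finset.range (M + 1), (G (n + 1) (x n) - G n (x n))‖ ≤
      ‖x 0‖ + ‖x M‖ + ∑ n ∈ Finset.range M, ‖x (n + 1) - x n‖ := by
  have hparts : ∑ n ∈ Finset.range (M + 1), (G (n + 1) (x n) - G n (x n)) =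
      G (M + 1) (x M) - G 0 (x 0) - ∑ n ∈ Finset.range M, G (n + 1) (x (n + 1) - x n) := by
    clear hG
    induction M with
    | zero => simp
    | succ M ih =>
      rw [Finset.sum_range_succ, ih, Finset.sum_range_succ _ M, map_sub]
      abel
  calc _ ≤ ‖G (M + 1) (x M)‖ + ‖G 0 (x 0)‖
        + ∑ n ∈ Finset.range M, ‖G (n + 1) (x (n + 1) - x n)‖ := by
        rw [hparts]
        exact (norm_sub_le _ _).trans (add_le_add (norm_sub_le _ _) (norm_sum_le _ _))
    _ ≤ ‖x M‖ + ‖x 0‖ + ∑ n ∈ Finset.range M, ‖x (n + 1) - x n‖ := by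
        gcongr with n hn
        · exact hG _ le_rfl _
        · exact hG _ (Nat.zero_le _) _
        · exact hG _ (by have := Finset.mem_range.1 hn; lia) _
    _ = _ := by ring

lemma norm_step_sub_step_le {A : Type*} [CStarAlgebra A] {w u y : A} (hw : w ∈ unitary A)
    (hu : u ∈ unitary A) (hy : y ∈ unitary A) {v x o : A} (hx : x * w - w * x = o * w) :
    ‖(star (v * w * y) * (w * u) - star y * u)
        - (star (v * w * y) * (x * (w * u)) - star y * (x * u))‖ ≤
      ‖star v - 1 - o‖ + ‖star v - 1‖ * ‖x‖ := by
  have hww := Unitary.star_mul_self_of_mem hw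
  have how : star w * o * w = star w * x * w - x := by
    rw [mul_assoc, ← hx, mul_sub, ← mul_assoc, ← mul_assoc, hww, one_mul]
  have herr : (star (v * w * y) * (w * u) - star y * u)
        - (star (v * w * y) * (x * (w * u)) - star y * (x * u)) =
      star y * (star w * ((star v - 1 - o) - (star v - 1) * x) * w) * u := by
    have : star w * ((star v - 1 - o) - (star v - 1) * x) * w =
        star w * star v * w - star w * w - star w * o * w
          - (star w * star v * x * w - star w * x * w) := by
      noncomm_ring
    rw [this, how, hww, star_mul, star_mul]
    noncomm_ring
  rw [herr, CStarRing.norm_mul_mem_unitary _ hu,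
    CStarRing.norm_mem_unitary_mul _ (Unitary.star_mem hy), CStarRing.norm_mul_mem_unitary _ hw,
    CStarRing.norm_mem_unitary_mul _ (Unitary.star_mem hw)]
  exact (norm_sub_le _ _).trans (add_le_add le_rfl (norm_mul_le _ _))

variable {H : Type*} [NormedAddCommGroup H] [InnerProductSpace ℂ H] [CompleteSpace H]
  {W V X O : ℕ → H →L[ℂ] H}

lemma evolution_mem_unitary {N : ℕ} (hW : ∀ n < N, W n ∈ unitary (H →L[ℂ] H)) :
    ∀ n ≤ N, evolution W n ∈ unitary (H →L[ℂ] H)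
  | 0, _ => one_mem _
  | n + 1, hn => mul_mem (hW n hn) (evolution_mem_unitary hW n (Nat.le_of_succ_le hn))

lemma norm_evolution_le {N : ℕ} (hW : ∀ n < N, ‖W n‖ ≤ 1) : ∀ n ≤ N, ‖evolution W n‖ ≤ 1
  | 0, _ => ContinuousLinearMap.norm_id_le
  | n + 1, hn => (norm_mul_le _ _).trans <| mul_le_one₀ (hW n hn) (norm_nonneg _)
      (norm_evolution_le hW n (Nat.le_of_succ_le hn))

lemma norm_evolution_sub_le {M : ℕ} (hW : ∀ n ≤ M, W n ∈ unitary (H →L[ℂ] H))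
    (hV : ∀ n ≤ M, V n ∈ unitary (H →L[ℂ] H)) (hX : ∀ n ≤ M, X n * W n - W n * X n = O n * W n) :
    ‖evolution W (M + 1) - evolution (fun n => V n * W n) (M + 1)‖ ≤
      ‖X 0‖ + ‖X M‖ + ∑ n ∈ Finset.range M, ‖X (n + 1) - X n‖
      + ∑ n ∈ Finset.range (M + 1), (‖star (V n) - 1 - O n‖ + ‖star (V n) - 1‖ * ‖X n‖) := by
  set U := evolution W
  set Y := evolution fun n => V n * W n
  have hUu : ∀ n ≤ M + 1, U n ∈ unitary (H →L[ℂ] H) :=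
    evolution_mem_unitary fun n hn => hW n (Nat.lt_succ_iff.1 hn)
  have hYu : ∀ n ≤ M + 1, Y n ∈ unitary (H →L[ℂ] H) := evolution_mem_unitary fun n hn =>
    mul_mem (hV n (Nat.lt_succ_iff.1 hn)) (hW n (Nat.lt_succ_iff.1 hn))
  let G (n : ℕ) : (H →L[ℂ] H) →+ (H →L[ℂ] H) :=
    (AddMonoidHom.mulLeft (star (Y n))).comp (AddMonoidHom.mulRight (U n))
  have hG : ∀ n ≤ M + 1, ∀ x, ‖G n x‖ ≤ ‖x‖ := fun n hn x => by
    change ‖star (Y n) * (x * U n)‖ ≤ ‖x‖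
    rw [CStarRing.norm_mem_unitary_mul _ (Unitary.star_mem (hYu n hn)),
      CStarRing.norm_mul_mem_unitary _ (hUu n hn)]
  have htele : star (Y (M + 1)) * (U (M + 1) - Y (M + 1)) =
      ∑ n ∈ Finset.range (M + 1), (G (n + 1) (X n) - G n (X n))
      + ∑ n ∈ Finset.range (M + 1), ((star (Y (n + 1)) * U (n + 1) - star (Y n) * U n)
          - (G (n + 1) (X n) - G n (X n))) := by
    simp only [← Finset.sum_add_distrib, add_sub_cancel]
    rw [Finset.sum_range_sub fun n => star (Y n) * U n, mul_sub,
      Unitary.star_mul_self_of_mem (hYu _ le_rfl)]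
    simp [U, Y, evolution]
  rw [← CStarRing.norm_mem_unitary_mul _ (Unitary.star_mem (hYu _ le_rfl)), htele]
  refine (norm_add_le _ _).trans (add_le_add (norm_sum_sub_le_of_norm_le G X hG) ?_)
  refine (norm_sum_le _ _).trans (Finset.sum_le_sum fun n hn => ?_)
  have hnM : n ≤ M := Nat.lt_succ_iff.1 (Finset.mem_range.1 hn)
  exact norm_step_sub_step_le (hW n hnM) (hUu n (by lia)) (hYu n (by lia)) (hX n hnM)

end Evolution

section Arcs

open Complex (I exp)
open Real (pi pi_pos two_pi_pos)

/-- The image of the interval `[a, b]` of angles, so that `IsArc A` says `A = arc a b` with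
`a ≤ b`. -/
def arc (a b : ℝ) : Set ℂ := (fun θ : ℝ => exp (θ * I)) '' Set.Icc a b

variable {A B : Set ℂ} {a b α β : ℝ}

lemma exp_mem_arc {θ : ℝ} (ha : a ≤ θ) (hb : θ ≤ b) : exp (θ * I) ∈ arc a b := ⟨θ, ⟨ha, hb⟩, rfl⟩

lemma isArc_arc (hab : a ≤ b) : IsArc (arc a b) := ⟨a, b, hab, rfl⟩

lemma arc_add_int_mul_two_pi (a b : ℝ) (m : ℤ) :
    arc (a + m * (2 * pi)) (b + m * (2 * pi)) = arc a b := by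
  unfold arc
  rw [← Set.image_add_const_Icc, Set.image_image]
  refine Set.image_congr fun θ _ => ?_
  exact_mod_cast Complex.exp_mul_I_periodic.int_mul m θ

lemma IsArc.isCompact (hA : IsArc A) : IsCompact A := by
  obtain ⟨a, b, -, rfl⟩ := hA
  exact isCompact_Icc.image (by fun_prop)

lemma IsArc.nonempty (hA : IsArc A) : A.Nonempty := by
  obtain ⟨a, b, h, rfl⟩ := hA
  exact (Set.nonempty_Icc.2 h).image _

lemma IsArc.norm_eq_one (hA : IsArc A) {x : ℂ} (hx : x ∈ A) : ‖x‖ = 1 := by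
  obtain ⟨a, b, -, rfl⟩ := hA
  obtain ⟨θ, -, rfl⟩ := hx
  exact Complex.norm_exp_ofReal_mul_I θ

lemma angle_exp_le_abs_sub (x y : ℝ) :
    InnerProductGeometry.angle (exp (x * I)) (exp (y * I)) ≤ |x - y| := by
  by_cases h : |x - y| < pi
  · rw [Complex.angle_exp_exp, (toIocMod_eq_self two_pi_pos).2]
    rw [abs_lt] at h
    constructor <;> linarith
  · exact (InnerProductGeometry.angle_le_pi _ _).trans (not_lt.1 h)

lemma angularDist_le {x y : ℂ} (hx : x ∈ A) (hy : y ∈ B) :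
    angularDist A B ≤ InnerProductGeometry.angle x y :=
  csInf_le ⟨0, by rintro _ ⟨u, -, v, -, rfl⟩; exact InnerProductGeometry.angle_nonneg _ _⟩
    ⟨x, hx, y, hy, rfl⟩

lemma angularDist_comm (A B : Set ℂ) : angularDist A B = angularDist B A := by
  rw [angularDist, angularDist, Set.image2_swap]
  congr 1
  simp only [InnerProductGeometry.angle_comm]

lemma eq_of_angle_eq_zero {x y : ℂ} (hx : ‖x‖ = 1) (hy : ‖y‖ = 1)
    (h : InnerProductGeometry.angle x y = 0) : x = y := by
  have hinner := InnerProductGeometry.inner_eq_mul_norm_of_angle_eq_zero h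
  rw [hx, hy, mul_one] at hinner
  exact (inner_eq_one_iff_of_norm_eq_one hx hy).1 hinner

lemma angularDist_pos (hA : IsArc A) (hB : IsArc B) (h : Disjoint A B) :
    0 < angularDist A B := by
  have hne : ∀ {x : ℂ}, ‖x‖ = 1 → x ≠ 0 := fun h => norm_ne_zero_iff.1 (h ▸ one_ne_zero)
  have hc : IsCompact (Set.image2 InnerProductGeometry.angle A B) := by
    rw [← Set.image_prod]
    refine (hA.isCompact.prod hB.isCompact).image_of_continuousOn fun p hp => ?_
    exact (InnerProductGeometry.continuousAt_angle (hne (hA.norm_eq_one hp.1))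
      (hne (hB.norm_eq_one hp.2))).continuousWithinAt
  obtain ⟨x, hx, y, hy, hxy⟩ := hc.sInf_mem (hA.nonempty.image2 hB.nonempty)
  rw [angularDist, ← hxy]
  refine (InnerProductGeometry.angle_nonneg _ _).lt_of_ne' fun h0 => ?_
  exact h.ne_of_mem hx hy (eq_of_angle_eq_zero (hA.norm_eq_one hx) (hB.norm_eq_one hy) h0)

lemma add_angularDist_le (hab : a ≤ b) (hαβ : α ≤ β) (h : Disjoint (arc a b) (arc α β))
    (ha : a ≤ β) : b + angularDist (arc a b) (arc α β) ≤ α := by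
  have hbα : b < α := by
    by_contra! hαb
    exact h.ne_of_mem (exp_mem_arc (le_max_left a α) (max_le hab hαb))
      (exp_mem_arc (le_max_right a α) (max_le ha hαβ)) rfl
  have hle := (angularDist_le (exp_mem_arc hab le_rfl) (exp_mem_arc le_rfl hαβ)).trans
    (angle_exp_le_abs_sub b α)
  rw [abs_of_neg (sub_neg.2 hbα)] at hle
  linarith

lemma exists_int_add_angularDist_le (hab : a ≤ b) (hαβ : α ≤ β)
    (h : Disjoint (arc a b) (arc α β)) :
    ∃ m : ℤ, b + angularDist (arc a b) (arc α β) ≤ α + m * (2 * pi) ∧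
      β + m * (2 * pi) + angularDist (arc a b) (arc α β) ≤ a + 2 * pi := by
  obtain ⟨m, hm⟩ : ∃ m : ℤ, α + m * (2 * pi) ∈ Set.Ico a (a + 2 * pi) := by
    refine ⟨-toIcoDiv two_pi_pos a α, ?_⟩
    have := sub_toIcoDiv_zsmul_mem_Ico two_pi_pos a α
    rw [zsmul_eq_mul] at this
    push_cast
    rwa [neg_mul, ← sub_eq_add_neg]
  refine ⟨m, ?_, ?_⟩
  · rw [← arc_add_int_mul_two_pi α β m] at h ⊢
    exact add_angularDist_le hab (by linarith) h (by linarith [hm.1])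
  · rw [angularDist_comm, ← arc_add_int_mul_two_pi α β m]
    rw [← arc_add_int_mul_two_pi α β m] at h
    have h2 := arc_add_int_mul_two_pi a b 1
    rw [Int.cast_one, one_mul] at h2
    rw [← h2] at h ⊢
    exact add_angularDist_le (by linarith) (by linarith) h.symm (by linarith [hm.2])

lemma norm_exp_mul_I_sub (θ c : ℝ) :
    ‖exp (θ * I) - exp (c * I)‖ = 2 * |Real.sin ((θ - c) / 2)| := by
  have hfactor : exp (θ * I) - exp (c * I) =
      exp (c * I) * (exp (I * ((θ - c : ℝ) : ℂ)) - 1) := by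
    rw [mul_sub, ← Complex.exp_add, mul_one]
    congr 2
    push_cast
    ring
  rw [hfactor, norm_mul, Complex.norm_exp_ofReal_mul_I, one_mul,
    Complex.norm_exp_I_mul_ofReal_sub_one, norm_mul, Real.norm_eq_abs, Real.norm_eq_abs, abs_two]

lemma norm_exp_mul_I_sub_le {θ c p : ℝ} (h : |θ - c| ≤ p) (hp : p ≤ pi) :
    ‖exp (θ * I) - exp (c * I)‖ ≤ 2 * Real.sin (p / 2) := by
  have hθ : |(θ - c) / 2| ≤ p / 2 := by
    rw [abs_div, abs_two]
    gcongr
  rw [norm_exp_mul_I_sub, Real.abs_sin_eq_sin_abs_of_abs_le_pi (by linarith [pi_pos])]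
  gcongr
  exact Real.sin_le_sin_of_le_of_le_pi_div_two (by linarith [abs_nonneg ((θ - c) / 2)])
    (by linarith) hθ

lemma le_norm_exp_mul_I_sub {θ c q : ℝ} (hq : 0 ≤ q) (h : c + q ≤ θ) (h' : θ + q ≤ c + 2 * pi) :
    2 * Real.sin (q / 2) ≤ ‖exp (θ * I) - exp (c * I)‖ := by
  rw [norm_exp_mul_I_sub]
  gcongr
  refine le_trans ?_ (le_abs_self _)
  rcases le_total ((θ - c) / 2) (pi / 2) with hθ | hθ
  · exact Real.sin_le_sin_of_le_of_le_pi_div_two (by linarith [pi_pos]) hθ (by linarith)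
  · rw [← Real.sin_pi_sub ((θ - c) / 2)]
    exact Real.sin_le_sin_of_le_of_le_pi_div_two (by linarith [pi_pos]) (by linarith)
      (by linarith)

lemma mul_le_sin_of_le_pi_div_four {x : ℝ} (hx : 0 < x) (h : x ≤ pi / 4) :
    0.85 * x ≤ Real.sin x := by
  have hsin := Real.sin_gt_sub_cube hx
  have hx' : x ≤ 0.7875 := h.trans (by linarith [Real.pi_lt_d2])
  have hx2 : x ^ 2 ≤ 0.7 := by nlinarith only [hx, hx']
  linarith [mul_le_mul_of_nonneg_right hx2 hx.le, pow_succ x 2]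

lemma two_mul_sin_add_half_le {p Δ : ℝ} (hp : 0 ≤ p) (hΔ : 0 < Δ) (h : 2 * p + Δ ≤ pi) :
    2 * Real.sin (p / 2) + Δ / 2 ≤ 2 * Real.sin ((p + Δ) / 2) := by
  have hdiff : Real.sin ((p + Δ) / 2) - Real.sin (p / 2) =
      2 * Real.sin (Δ / 4) * Real.cos ((2 * p + Δ) / 4) := by
    rw [Real.sin_sub_sin]
    congr 2 <;> ring_nf
  have hsin := mul_le_sin_of_le_pi_div_four (x := Δ / 4) (by positivity) (by linarith)
  have hcos : Real.cos (pi / 4) ≤ Real.cos ((2 * p + Δ) / 4) :=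
    Real.cos_le_cos_of_nonneg_of_le_pi (by positivity) (by linarith) (by linarith)
  rw [Real.cos_pi_div_four] at hcos
  have hsqrt : (1.4 : ℝ) ≤ √2 := Real.le_sqrt_of_sq_le (by norm_num)
  have hprod : 0.85 * (Δ / 4) * 0.7 ≤ Real.sin (Δ / 4) * Real.cos ((2 * p + Δ) / 4) := by
    gcongr
    · linarith
    · linarith
  linarith

lemma exists_disc_of_length_le (hab : a ≤ b) (hαβ : α ≤ β) (hlen : b - a ≤ β - α)
    (h : Disjoint (arc a b) (arc α β)) :
    ∃ (z : ℂ) (r ρ : ℝ), r + angularDist (arc a b) (arc α β) / 2 ≤ ρ ∧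
      (∀ w ∈ arc a b, ‖w - z‖ ≤ r) ∧ ∀ w ∈ arc α β, ρ ≤ ‖w - z‖ := by
  have hΔ := angularDist_pos (isArc_arc hab) (isArc_arc hαβ) h
  obtain ⟨m, hα, hβ⟩ := exists_int_add_angularDist_le hab hαβ h
  set Δ := angularDist (arc a b) (arc α β)
  refine ⟨exp (((a + b) / 2 : ℝ) * I), 2 * Real.sin ((b - a) / 2 / 2),
    2 * Real.sin (((b - a) / 2 + Δ) / 2), ?_, ?_, ?_⟩
  · exact two_mul_sin_add_half_le (by linarith) hΔ (by linarith)
  · rintro _ ⟨θ, ⟨ha, hb⟩, rfl⟩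
    exact norm_exp_mul_I_sub_le (abs_le.2 ⟨by linarith, by linarith⟩) (by linarith)
  · rw [← arc_add_int_mul_two_pi α β m]
    rintro _ ⟨θ, ⟨ha, hb⟩, rfl⟩
    exact le_norm_exp_mul_I_sub (by linarith) (by linarith) (by linarith)

-- Centring the disc on the shorter arc keeps the relevant angles in the range where the chord
-- length `2 sin (x / 2)` grows at rate at least `1 / 2`.
lemma IsArc.exists_disc (hA : IsArc A) (hB : IsArc B) (h : Disjoint A B) :
    ∃ (z : ℂ) (r ρ : ℝ), r + angularDist A B / 2 ≤ ρ ∧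
      (((∀ w ∈ A, ‖w - z‖ ≤ r) ∧ ∀ w ∈ B, ρ ≤ ‖w - z‖) ∨
        ((∀ w ∈ B, ‖w - z‖ ≤ r) ∧ ∀ w ∈ A, ρ ≤ ‖w - z‖)) := by
  obtain ⟨a, b, hab, rfl⟩ := hA
  obtain ⟨α, β, hαβ, rfl⟩ := hB
  rcases le_total (b - a) (β - α) with hlen | hlen
  · obtain ⟨z, r, ρ, hrρ, hz⟩ := exists_disc_of_length_le hab hαβ hlen h
    exact ⟨z, r, ρ, hrρ, Or.inl hz⟩
  · obtain ⟨z, r, ρ, hrρ, hz⟩ := exists_disc_of_length_le hαβ hab hlen h.symm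
    rw [angularDist_comm] at hrρ
    exact ⟨z, r, ρ, hrρ, Or.inr hz⟩

end Arcs

section Spectral

variable {H : Type*} [NormedAddCommGroup H] [InnerProductSpace ℂ H] [CompleteSpace H]
  {W W' : H →L[ℂ] H} {σ τ σ' τ' A B : Set ℂ} {z : ℂ} {r ρ : ℝ}

/-- The spectrum of the normal operator `W` is the disjoint union of the closed sets `σ` and `τ`,
so that `spectralProj W σ` and `spectralProj W τ` are complementary spectral projections. -/
structure IsSpectralPartition (W : H →L[ℂ] H) (σ τ : Set ℂ) : Prop where
  isStarNormal : IsStarNormal W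
  union_eq : σ ∪ τ = spectrum ℂ W
  disjoint : Disjoint σ τ
  isClosed_left : IsClosed σ
  isClosed_right : IsClosed τ

lemma isClosed_of_union_eq_spectrum (hunion : σ ∪ τ = spectrum ℂ W) (hσ : σ ⊆ A) (hτ : τ ⊆ B)
    (hA : IsClosed A) (hAB : Disjoint A B) : IsClosed σ := by
  have h : σ = spectrum ℂ W ∩ A := by
    rw [← hunion, Set.union_inter_distrib_right, Set.inter_eq_left.2 hσ,
      (hAB.symm.mono_left hτ).inter_eq, Set.union_empty]
  rw [h]
  exact (spectrum.isClosed W).inter hA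

lemma isSpectralPartition_of_isArc (hW : W ∈ unitary (H →L[ℂ] H)) (hunion : σ ∪ τ = spectrum ℂ W)
    (hσ : σ ⊆ A) (hτ : τ ⊆ B) (hA : IsArc A) (hB : IsArc B) (hAB : Disjoint A B) :
    IsSpectralPartition W σ τ where
  isStarNormal := isStarNormal_of_mem_unitary hW
  union_eq := hunion
  disjoint := hAB.mono hσ hτ
  isClosed_left := isClosed_of_union_eq_spectrum hunion hσ hτ hA.isCompact.isClosed hAB
  isClosed_right := isClosed_of_union_eq_spectrum (by rw [Set.union_comm, hunion]) hτ hσ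
    hB.isCompact.isClosed hAB.symm

namespace IsSpectralPartition

lemma symm (h : IsSpectralPartition W σ τ) : IsSpectralPartition W τ σ :=
  ⟨h.isStarNormal, by rw [Set.union_comm, h.union_eq], h.disjoint.symm, h.isClosed_right,
    h.isClosed_left⟩

lemma continuousOn_indicator (h : IsSpectralPartition W σ τ) {f : ℂ → ℂ} (hf : ContinuousOn f σ) :
    ContinuousOn (σ.indicator f) (spectrum ℂ W) := by
  rw [← h.union_eq]
  refine (hf.congr fun _ hx => Set.indicator_of_mem hx f).union_of_isClosed
    (continuousOn_const (c := 0) |>.congr fun _ hx => ?_) h.isClosed_left h.isClosed_right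
  exact Set.indicator_of_notMem (Set.disjoint_right.1 h.disjoint hx) f

lemma spectralProj_right (h : IsSpectralPartition W σ τ) :
    spectralProj W τ = 1 - spectralProj W σ := by
  have := h.isStarNormal
  rw [spectralProj, spectralProj, ← cfc_const_one ℂ W,
    ← cfc_sub _ _ W continuousOn_const (h.continuousOn_indicator continuousOn_const)]
  refine cfc_congr fun x hx => ?_
  rw [← h.union_eq] at hx
  rcases hx with hx | hx
  · simp [hx, Set.disjoint_left.1 h.disjoint hx]
  · simp [hx, Set.disjoint_right.1 h.disjoint hx]

lemma isStarProjection (h : IsSpectralPartition W σ τ) : IsStarProjection (spectralProj W σ) := by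
  have hcont := h.continuousOn_indicator (continuousOn_const (c := (1 : ℂ)))
  constructor
  · rw [IsIdempotentElem, spectralProj, ← cfc_mul _ _ W hcont hcont]
    refine cfc_congr fun x _ => ?_
    by_cases hx : x ∈ σ <;> simp [hx]
  · rw [IsSelfAdjoint, spectralProj, ← cfc_star]
    refine cfc_congr fun x _ => ?_
    by_cases hx : x ∈ σ <;> simp [hx]

lemma commute (h : IsSpectralPartition W σ τ) : Commute W (spectralProj W σ) := by
  have := h.isStarNormal
  have hcomm := cfc_commute_cfc (fun w => w) (σ.indicator fun _ => (1 : ℂ)) W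
  rwa [cfc_id' ℂ W] at hcomm

lemma sub_algebraMap_eq_cfc (h : IsSpectralPartition W σ τ) (z : ℂ) :
    W - algebraMap ℂ (H →L[ℂ] H) z = cfc (fun w => w - z) W := by
  have := h.isStarNormal
  rw [cfc_sub _ _ W, cfc_id' ℂ W, cfc_const z W]

lemma norm_sub_mul_spectralProj_le (h : IsSpectralPartition W σ τ) (hr : 0 ≤ r)
    (hz : ∀ w ∈ σ, ‖w - z‖ ≤ r) :
    ‖(W - algebraMap ℂ (H →L[ℂ] H) z) * spectralProj W σ‖ ≤ r := by
  rw [h.sub_algebraMap_eq_cfc, spectralProj,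
    ← cfc_mul _ _ W (by fun_prop) (h.continuousOn_indicator continuousOn_const)]
  refine norm_cfc_le hr fun x _ => ?_
  by_cases hx : x ∈ σ
  · simpa [hx] using hz x hx
  · simpa [hx] using hr

lemma exists_mul_eq_one_sub_spectralProj (h : IsSpectralPartition W σ τ) (hρ : 0 < ρ)
    (hz : ∀ w ∈ τ, ρ ≤ ‖w - z‖) :
    ∃ g, (W - algebraMap ℂ (H →L[ℂ] H) z) * g = 1 - spectralProj W σ ∧
      g * (W - algebraMap ℂ (H →L[ℂ] H) z) = 1 - spectralProj W σ ∧ ρ * ‖g‖ ≤ 1 := by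
  have hne : ∀ w ∈ τ, w - z ≠ 0 := fun w hw => norm_pos_iff.1 (hρ.trans_le (hz w hw))
  have hcont : ContinuousOn (τ.indicator fun w => (w - z)⁻¹) (spectrum ℂ W) :=
    h.symm.continuousOn_indicator (ContinuousOn.inv₀ (by fun_prop) hne)
  have hmul : (W - algebraMap ℂ (H →L[ℂ] H) z) * cfc (τ.indicator fun w => (w - z)⁻¹) W =
      1 - spectralProj W σ := by
    rw [← h.spectralProj_right, h.sub_algebraMap_eq_cfc, spectralProj,
      ← cfc_mul _ _ W (by fun_prop) hcont]
    refine cfc_congr fun x _ => ?_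
    by_cases hx : x ∈ τ
    · simp [hx, hne x hx]
    · simp [hx]
  refine ⟨_, hmul, ?_, ?_⟩
  · rw [← hmul, h.sub_algebraMap_eq_cfc]
    exact (cfc_commute_cfc _ _ W).eq
  · rw [← le_div_iff₀' hρ, one_div]
    refine norm_cfc_le (by positivity) fun x _ => ?_
    by_cases hx : x ∈ τ
    · simpa [hx] using inv_anti₀ hρ (hz x hx)
    · simpa [hx] using hρ.le

lemma discSeparated (h : IsSpectralPartition W σ τ) (hr : 0 ≤ r) (hρ : 0 < ρ)
    (hσ : ∀ w ∈ σ, ‖w - z‖ ≤ r) (hτ : ∀ w ∈ τ, ρ ≤ ‖w - z‖) :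
    DiscSeparated W (spectralProj W σ) z r ρ :=
  ⟨h.isStarProjection, h.commute, h.norm_sub_mul_spectralProj_le hr hσ,
    h.exists_mul_eq_one_sub_spectralProj hρ hτ⟩

lemma exists_discSeparated (h : IsSpectralPartition W σ τ) (h' : IsSpectralPartition W' σ' τ')
    (hA : IsArc A) (hB : IsArc B) (hAB : Disjoint A B) (hσ : σ ∪ σ' ⊆ A) (hτ : τ ∪ τ' ⊆ B) :
    ∃ (z : ℂ) (r ρ : ℝ), r + angularDist A B / 2 ≤ ρ ∧
      ((DiscSeparated W (spectralProj W σ) z r ρ ∧ DiscSeparated W' (spectralProj W' σ') z r ρ) ∨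
        (DiscSeparated W (1 - spectralProj W σ) z r ρ ∧
          DiscSeparated W' (1 - spectralProj W' σ') z r ρ)) := by
  rw [Set.union_subset_iff] at hσ hτ
  have hΔ := angularDist_pos hA hB hAB
  obtain ⟨z, r, ρ, hrρ, ⟨hzA, hzB⟩ | ⟨hzB, hzA⟩⟩ := hA.exists_disc hB hAB
  · have hr : 0 ≤ r := (norm_nonneg _).trans (hzA _ hA.nonempty.some_mem)
    exact ⟨z, r, ρ, hrρ, Or.inl
      ⟨h.discSeparated hr (by linarith) (fun w hw => hzA w (hσ.1 hw)) fun w hw => hzB w (hτ.1 hw),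
      h'.discSeparated hr (by linarith) (fun w hw => hzA w (hσ.2 hw)) fun w hw => hzB w (hτ.2 hw)⟩⟩
  · have hr : 0 ≤ r := (norm_nonneg _).trans (hzB _ hB.nonempty.some_mem)
    rw [← h.spectralProj_right, ← h'.spectralProj_right]
    exact ⟨z, r, ρ, hrρ, Or.inr
      ⟨h.symm.discSeparated hr (by linarith) (fun w hw => hzB w (hτ.1 hw))
        fun w hw => hzA w (hσ.1 hw),
      h'.symm.discSeparated hr (by linarith) (fun w hw => hzB w (hτ.2 hw))
        fun w hw => hzA w (hσ.2 hw)⟩⟩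

lemma sylvesterBound (h : IsSpectralPartition W σ τ) (h' : IsSpectralPartition W' σ' τ')
    (hA : IsArc A) (hB : IsArc B) (hAB : Disjoint A B) (hσ : σ ∪ σ' ⊆ A) (hτ : τ ∪ τ' ⊆ B) :
    SylvesterBound W (spectralProj W σ) W' (spectralProj W' σ') (angularDist A B / 2) := by
  have hΔ := angularDist_pos hA hB hAB
  obtain ⟨z, r, ρ, hrρ, ⟨hd, hd'⟩ | ⟨hd, hd'⟩⟩ := h.exists_discSeparated h' hA hB hAB hσ hτ
  · exact (hd.sylvesterBound hd' (by linarith)).mono (by linarith)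
  · exact (sylvesterBound_one_sub_iff.1 (hd.sylvesterBound hd' (by linarith))).mono (by linarith)

lemma sylvesterSolvable (h : IsSpectralPartition W σ τ) (hA : IsArc A) (hB : IsArc B)
    (hAB : Disjoint A B) (hσ : σ ⊆ A) (hτ : τ ⊆ B) : SylvesterSolvable W (spectralProj W σ) := by
  have hΔ := angularDist_pos hA hB hAB
  obtain ⟨z, r, ρ, hrρ, ⟨hd, -⟩ | ⟨hd, -⟩⟩ :=
    h.exists_discSeparated h hA hB hAB (Set.union_subset hσ hσ) (Set.union_subset hτ hτ)
  · exact hd.sylvesterSolvable (by linarith)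
  · exact sylvesterSolvable_one_sub_iff.1 (hd.sylvesterSolvable (by linarith))

end IsSpectralPartition

end Spectral

section Steps

/-- The walk operators `w`, `w'` of two consecutive steps differ by at most `a`, and their spectral
projections `p`, `p'` are separated by a common gap, which enters only through the constant `δ` of
the Sylvester bounds (half of the angular distance of the arcs). -/
structure IsAdiabaticStep {A : Type*} [CStarAlgebra A] (w w' p p' : A) (a δ : ℝ) : Prop where
  mem_unitary : w ∈ unitary A
  isStarProjection_left : IsStarProjection p
  isStarProjection_right : IsStarProjection p'
  commute_left : Commute w p
  commute_right : Commute w' p'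
  pos : 0 < δ
  norm_sub_le : ‖w' - w‖ ≤ a
  sylvesterBound : SylvesterBound w' p' w p δ
  sylvesterBound_self : SylvesterBound w p w p δ
  sylvesterSolvable : SylvesterSolvable w p

namespace IsAdiabaticStep

variable {A : Type*} [CStarAlgebra A] {w w' w'' p p' p'' x x' : A} {a b δ : ℝ}

lemma nonneg (h : IsAdiabaticStep w w' p p' a δ) : 0 ≤ a := (norm_nonneg _).trans h.norm_sub_le

lemma norm_proj_sub_le (h : IsAdiabaticStep w w' p p' a δ) : ‖p' - p‖ ≤ a / δ := by
  rw [le_div_iff₀' h.pos]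
  exact (h.sylvesterBound.norm_proj_sub_le h.isStarProjection_left).trans h.norm_sub_le

lemma norm_proj_sub_lt_one (h : IsAdiabaticStep w w' p p' a δ) (ha : 2 * a ≤ δ) :
    ‖p' - p‖ < 1 := by
  refine h.norm_proj_sub_le.trans_lt ((div_lt_one h.pos).2 ?_)
  linarith [h.pos]

lemma exists_isCorrector (h : IsAdiabaticStep w w' p p' a δ) :
    ∃ x, IsCorrector w p (offTransfer p' p) x :=
  h.sylvesterSolvable.exists_isCorrector h.commute_left p'

lemma norm_corrector_le (h : IsAdiabaticStep w w' p p' a δ)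
    (hx : IsCorrector w p (offTransfer p' p) x) : ‖x‖ ≤ a / δ ^ 2 := by
  rw [pow_two, ← div_div, le_div_iff₀' h.pos]
  calc δ * ‖x‖ ≤ ‖offTransfer p' p‖ := hx.norm_le h.mem_unitary h.sylvesterBound_self
    _ ≤ ‖p' - p‖ := norm_offTransfer_le h.isStarProjection_left h.isStarProjection_right
    _ ≤ a / δ := h.norm_proj_sub_le

lemma norm_proj_second_diff_le (h : IsAdiabaticStep w w' p p' a δ)
    (h' : IsAdiabaticStep w' w'' p' p'' a δ) (hb : ‖(w'' - w') - (w' - w)‖ ≤ b) :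
    ‖(p'' - p') - (p' - p)‖ ≤ b / δ + 6 * (a / δ) ^ 2 := by
  have hδ := h.pos
  have ha := h.nonneg
  have hsecond := h'.sylvesterBound_self.norm_proj_second_diff_le hδ.le h.isStarProjection_left
    h.isStarProjection_right h'.isStarProjection_right h.commute_left h.commute_right
    h'.commute_right
  refine le_of_mul_le_mul_left ?_ hδ
  calc δ * ‖(p'' - p') - (p' - p)‖
      ≤ b + 2 * (a * (a / δ)) + 2 * (a * (a / δ)) + δ * ((a / δ) ^ 2 + (a / δ) ^ 2) := by
        refine hsecond.trans ?_
        gcongr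
        · exact h'.norm_sub_le
        · exact h'.norm_proj_sub_le
        · exact h.norm_sub_le
        · exact h.norm_proj_sub_le
        · exact h'.norm_proj_sub_le
        · exact h.norm_proj_sub_le
    _ = δ * (b / δ + 6 * (a / δ) ^ 2) := by
        field_simp
        ring

lemma norm_offTransfer_sub_le (h : IsAdiabaticStep w w' p p' a δ)
    (h' : IsAdiabaticStep w' w'' p' p'' a δ) (hb : ‖(w'' - w') - (w' - w)‖ ≤ b) :
    ‖offTransfer p'' p' - offTransfer p' p‖ ≤ b / δ + 8 * (a / δ) ^ 2 :=
  calc _ ≤ ‖(p'' - p') - (p' - p)‖ + ‖p'' - p'‖ ^ 2 + ‖p' - p‖ ^ 2 :=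
        DiscreteAdiabatic.norm_offTransfer_sub_le h.isStarProjection_left h.isStarProjection_right
          h'.isStarProjection_right
    _ ≤ (b / δ + 6 * (a / δ) ^ 2) + (a / δ) ^ 2 + (a / δ) ^ 2 := by
        gcongr
        · exact h.norm_proj_second_diff_le h' hb
        · exact h'.norm_proj_sub_le
        · exact h.norm_proj_sub_le
    _ = b / δ + 8 * (a / δ) ^ 2 := by ring

lemma norm_corrector_sub_le (h : IsAdiabaticStep w w' p p' a δ)
    (h' : IsAdiabaticStep w' w'' p' p'' a δ) (hb : ‖(w'' - w') - (w' - w)‖ ≤ b)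
    (hx : IsCorrector w p (offTransfer p' p) x) (hx' : IsCorrector w' p' (offTransfer p'' p') x') :
    ‖x' - x‖ ≤ b / δ ^ 2 + 12 * (a ^ 2 / δ ^ 3) + a ^ 2 / δ ^ 2 := by
  have hδ := h.pos
  have ha := h.nonneg
  refine le_of_mul_le_mul_left ?_ hδ
  calc δ * ‖x' - x‖
      ≤ ‖offTransfer p'' p' - offTransfer p' p‖ + ‖offTransfer p' p‖ * ‖w' - w‖
        + 2 * (‖w' - w‖ * ‖x‖) + δ * (2 * (‖p' - p‖ * ‖x‖)) :=
        hx.norm_sub_le hx' hδ.le h.isStarProjection_left h.isStarProjection_right h'.mem_unitary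
          h'.sylvesterBound_self
    _ ≤ (b / δ + 8 * (a / δ) ^ 2) + a / δ * a + 2 * (a * (a / δ ^ 2))
        + δ * (2 * (a / δ * (a / δ ^ 2))) := by
        have ho := (norm_offTransfer_le h.isStarProjection_left h.isStarProjection_right).trans
          h.norm_proj_sub_le
        gcongr
        · exact h.norm_offTransfer_sub_le h' hb
        · exact h.norm_sub_le
        · exact h.norm_sub_le
        · exact h.norm_corrector_le hx
        · exact h.norm_proj_sub_le
        · exact h.norm_corrector_le hx
    _ = δ * (b / δ ^ 2 + 12 * (a ^ 2 / δ ^ 3) + a ^ 2 / δ ^ 2) := by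
        field_simp
        ring

end IsAdiabaticStep

variable {H : Type*} [NormedAddCommGroup H] [InnerProductSpace ℂ H] [CompleteSpace H]

lemma IsAdiabaticStep.norm_remainder_le {W W' P P' X : H →L[ℂ] H} {a δ : ℝ}
    (h : IsAdiabaticStep W W' P P' a δ) (ha : 2 * a ≤ δ)
    (hX : IsCorrector W P (offTransfer P' P) X) :
    ‖star (transferV P' P) - 1 - offTransfer P' P‖ + ‖star (transferV P' P) - 1‖ * ‖X‖ ≤
      2 * (a ^ 2 / δ ^ 2 + a ^ 2 / δ ^ 3) := by
  have hδ := h.pos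
  have hP := h.isStarProjection_left
  have hP' := h.isStarProjection_right
  have hd := h.norm_proj_sub_lt_one ha
  have hd' := h.norm_proj_sub_le
  have hV : ‖star (transferV P' P) - 1‖ ≤ 2 * (a / δ) := by
    refine (norm_star_transferV_sub_one_le hP hP' hd).trans ?_
    nlinarith [norm_nonneg (P' - P)]
  calc _ ≤ 2 * (a / δ) ^ 2 + 2 * (a / δ) * (a / δ ^ 2) := by
        have := h.nonneg
        gcongr
        · refine (norm_star_transferV_sub_one_sub_le hP hP' hd).trans ?_
          gcongr
        · exact h.norm_corrector_le hX
    _ = _ := by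
        field_simp

-- Each step is available with the two neighbouring pairs of constants, so that the differences of
-- correctors at `n` can be estimated with the constants of index `n` alone.
lemma norm_evolution_sub_le_of_isAdiabaticStep {W P : ℕ → H →L[ℂ] H} {a b δ : ℕ → ℝ} {M : ℕ}
    (hstep : ∀ n ≤ M, ∀ m, m = n ∨ m = n + 1 →
      IsAdiabaticStep (W n) (W (n + 1)) (P n) (P (n + 1)) (a m) (δ m))
    (hsmall : ∀ n ≤ M, 2 * a n ≤ δ n)
    (hb : ∀ n < M, ‖(W (n + 2) - W (n + 1)) - (W (n + 1) - W n)‖ ≤ b (n + 1)) :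
    ‖evolution W (M + 1) - evolution (fun n => transferV (P (n + 1)) (P n) * W n) (M + 1)‖ ≤
      a 0 / δ 0 ^ 2 + a (M + 1) / δ (M + 1) ^ 2
      + ∑ n ∈ Finset.Ico 1 (M + 1),
          (b n / δ n ^ 2 + 12 * (a n ^ 2 / δ n ^ 3) + a n ^ 2 / δ n ^ 2)
      + ∑ n ∈ Finset.range (M + 1), 2 * (a n ^ 2 / δ n ^ 2 + a n ^ 2 / δ n ^ 3) := by
  have hself : ∀ n ≤ M, IsAdiabaticStep (W n) (W (n + 1)) (P n) (P (n + 1)) (a n) (δ n) :=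
    fun n hn => hstep n hn n (Or.inl rfl)
  have hnext : ∀ n ≤ M,
      IsAdiabaticStep (W n) (W (n + 1)) (P n) (P (n + 1)) (a (n + 1)) (δ (n + 1)) :=
    fun n hn => hstep n hn (n + 1) (Or.inr rfl)
  choose! X hX using fun n hn => (hself n hn).exists_isCorrector
  refine (norm_evolution_sub_le (fun n hn => (hself n hn).mem_unitary)
    (fun n hn => transferV_mem_unitary (hself n hn).isStarProjection_left
      (hself n hn).isStarProjection_right ((hself n hn).norm_proj_sub_lt_one (hsmall n hn)))
    fun n hn => (hX n hn).commutator_eq).trans ?_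
  rw [← Finset.sum_Ico_add' _ 0 M 1, Nat.Ico_zero_eq_range]
  gcongr with n hn n hn
  · exact (hself 0 (Nat.zero_le M)).norm_corrector_le (hX 0 (Nat.zero_le M))
  · exact (hnext M le_rfl).norm_corrector_le (hX M le_rfl)
  · have hn' := Finset.mem_range.1 hn
    exact (hnext n hn'.le).norm_corrector_sub_le (hself (n + 1) hn') (hb n hn') (hX n hn'.le)
      (hX (n + 1) hn')
  · have hn' := Nat.lt_succ_iff.1 (Finset.mem_range.1 hn)
    exact (hself n hn').norm_remainder_le (hsmall n hn') (hX n hn')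

end Steps

section Neighbours

variable {T n m k : ℕ} {c : ℕ → ℕ → ℝ} {AP AQ : ℕ → ℕ → Set ℂ}

lemma finite_neighbours (n : ℕ) (q : ℕ → Prop) :
    {m : ℕ | (m + 1 = n ∨ m = n ∨ m = n + 1) ∧ q m}.Finite :=
  (Set.finite_Iic (n + 1)).subset fun m hm => by
    have := hm.1
    rw [Set.mem_Iic]
    lia

lemma le_cHat (h : m + 1 = n ∨ m = n ∨ m = n + 1) (hm : m + k ≤ T) : c k m ≤ cHat T c k n :=
  le_csSup ((finite_neighbours n _).image _).bddAbove ⟨m, ⟨h, hm⟩, rfl⟩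

lemma gapCheck_le (h : m + 1 = n ∨ m = n ∨ m = n + 1) (hm : m ≤ T) :
    gapCheck T AP AQ n ≤ gap T AP AQ m :=
  csInf_le ((finite_neighbours n _).image _).bddBelow ⟨m, ⟨h, hm⟩, rfl⟩

lemma exists_gap_eq_gapCheck (AP AQ : ℕ → ℕ → Set ℂ) (hn : n ≤ T) :
    ∃ m ≤ T, gap T AP AQ m = gapCheck T AP AQ n := by
  have hne : (gap T AP AQ '' {m : ℕ | (m + 1 = n ∨ m = n ∨ m = n + 1) ∧ m ≤ T}).Nonempty :=
    ⟨_, n, ⟨Or.inr (Or.inl rfl), hn⟩, rfl⟩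
  obtain ⟨m, hm, hgap⟩ := hne.csInf_mem ((finite_neighbours n _).image _)
  exact ⟨m, hm.2, hgap⟩

lemma exists_gap_eq_angularDist (AP AQ : ℕ → ℕ → Set ℂ) (hn : n ≤ T) :
    ∃ k ≤ 2, n + k ≤ T ∧ (n < T → 1 ≤ k) ∧ gap T AP AQ n = angularDist (AP k n) (AQ k n) := by
  unfold gap
  split_ifs with h₂ h₁
  · exact ⟨2, le_rfl, h₂, fun _ => one_le_two, rfl⟩
  · exact ⟨1, one_le_two, h₁.le, fun _ => le_rfl, rfl⟩
  · exact ⟨0, zero_le_two, hn, by lia, rfl⟩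

end Neighbours

section GappedWalk

variable {H : Type*} [NormedAddCommGroup H] [InnerProductSpace ℂ H] [CompleteSpace H]

/-- The setting of the discrete adiabatic theorem: the unitaries `W 0, …, W T` have spectra split
into `σP` and `σQ`, the multistep spectra are enclosed by the arcs `AP` and `AQ`, and the `k`-th
differences are bounded by `c k / T ^ k` for `k = 1, 2`. -/
structure IsGappedWalk (T : ℕ) (W : ℕ → H →L[ℂ] H) (σP σQ : ℕ → Set ℂ) (AP AQ : ℕ → ℕ → Set ℂ)
    (c : ℕ → ℕ → ℝ) : Prop where
  mem_unitary : ∀ n ≤ T, W n ∈ unitary (H →L[ℂ] H)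
  union_eq : ∀ n ≤ T, σP n ∪ σQ n = spectrum ℂ (W n)
  areMultistepArcs : AreMultistepArcs T σP σQ AP AQ
  norm_fwdDiff_le : ∀ k n, k = 1 ∨ k = 2 → n + k ≤ T →
    ‖(fwdDiff 1)^[k] W n‖ ≤ c k n / (T : ℝ) ^ k

namespace IsGappedWalk

variable {T n m k l : ℕ} {W : ℕ → H →L[ℂ] H} {σP σQ : ℕ → Set ℂ} {AP AQ : ℕ → ℕ → Set ℂ}
  {c : ℕ → ℕ → ℝ}

lemma gap_pos (h : IsGappedWalk T W σP σQ AP AQ c) (hn : n ≤ T) : 0 < gap T AP AQ n := by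
  obtain ⟨k, hk, hnk, -, hgap⟩ := exists_gap_eq_angularDist AP AQ hn
  rw [hgap]
  have hA := h.areMultistepArcs
  exact angularDist_pos (hA.isArc_left k n hk hnk) (hA.isArc_right k n hk hnk)
    (hA.disjoint k n hk hnk)

lemma gapCheck_pos (h : IsGappedWalk T W σP σQ AP AQ c) (hn : n ≤ T) :
    0 < gapCheck T AP AQ n := by
  obtain ⟨m, hm, hgap⟩ := exists_gap_eq_gapCheck AP AQ hn
  exact hgap ▸ h.gap_pos hm

lemma norm_sub_le (h : IsGappedWalk T W σP σQ AP AQ c) (hn : n < T)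
    (hm : n + 1 = m ∨ n = m ∨ n = m + 1) : ‖W (n + 1) - W n‖ ≤ cHat T c 1 m / T := by
  have hdiff : ‖W (n + 1) - W n‖ ≤ c 1 n / T := by
    simpa [fwdDiff] using h.norm_fwdDiff_le 1 n (Or.inl rfl) hn
  exact hdiff.trans (by gcongr; exact le_cHat hm hn)

lemma norm_second_diff_le (h : IsGappedWalk T W σP σQ AP AQ c) (hn : n + 2 ≤ T) :
    ‖(W (n + 2) - W (n + 1)) - (W (n + 1) - W n)‖ ≤ cHat T c 2 (n + 1) / (T : ℝ) ^ 2 := by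
  have hdiff : ‖(W (n + 2) - W (n + 1)) - (W (n + 1) - W n)‖ ≤ c 2 n / (T : ℝ) ^ 2 := by
    simpa [fwdDiff, add_assoc] using h.norm_fwdDiff_le 2 n (Or.inr rfl) hn
  exact hdiff.trans (by gcongr; exact le_cHat (Or.inl rfl) hn)

lemma cHat_one_nonneg (h : IsGappedWalk T W σP σQ AP AQ c) (hT : 0 < T) (hn : n ≤ T) :
    0 ≤ cHat T c 1 n := by
  have hT' : (0 : ℝ) < T := Nat.cast_pos.2 hT
  obtain ⟨m, hm, hmn⟩ : ∃ m < T, m + 1 = n ∨ m = n ∨ m = n + 1 := by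
    rcases hn.lt_or_eq with hn | rfl
    · exact ⟨n, hn, Or.inr (Or.inl rfl)⟩
    · exact ⟨n - 1, by lia, by lia⟩
  have hnorm := (norm_nonneg _).trans (h.norm_sub_le hm hmn)
  rwa [le_div_iff₀ hT', zero_mul] at hnorm

lemma cHat_two_nonneg (h : IsGappedWalk T W σP σQ AP AQ c) (hn : 0 < n) (hnT : n < T) :
    0 ≤ cHat T c 2 n := by
  obtain ⟨m, rfl⟩ := Nat.exists_eq_succ_of_ne_zero hn.ne'
  have hT : (0 : ℝ) < (T : ℝ) ^ 2 := pow_pos (Nat.cast_pos.2 (by lia)) 2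
  have hnorm := (norm_nonneg _).trans (h.norm_second_diff_le hnT)
  rwa [le_div_iff₀ hT, zero_mul] at hnorm

lemma spectrum_subset (h : IsGappedWalk T W σP σQ AP AQ c) (hk : k ≤ 2) (hn : n + k ≤ T)
    (hl : l ≤ k) : σP (n + l) ⊆ AP k n ∧ σQ (n + l) ⊆ AQ k n :=
  ⟨(Set.subset_biUnion_of_mem (u := fun l => σP (n + l)) (Set.mem_Iic.2 hl)).trans
      (h.areMultistepArcs.subset_left k n hk hn),
    (Set.subset_biUnion_of_mem (u := fun l => σQ (n + l)) (Set.mem_Iic.2 hl)).trans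
      (h.areMultistepArcs.subset_right k n hk hn)⟩

lemma isSpectralPartition (h : IsGappedWalk T W σP σQ AP AQ c) (hn : n ≤ T) :
    IsSpectralPartition (W n) (σP n) (σQ n) :=
  have hA := h.areMultistepArcs
  have hsub := h.spectrum_subset zero_le_two hn (Nat.zero_le 0)
  isSpectralPartition_of_isArc (h.mem_unitary n hn) (h.union_eq n hn) hsub.1 hsub.2
    (hA.isArc_left 0 n zero_le_two hn) (hA.isArc_right 0 n zero_le_two hn)
    (hA.disjoint 0 n zero_le_two hn)

lemma isAdiabaticStep (h : IsGappedWalk T W σP σQ AP AQ c) (hn : n < T)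
    (hm : m = n ∨ m = n + 1) :
    IsAdiabaticStep (W n) (W (n + 1)) (spectralProj (W n) (σP n))
      (spectralProj (W (n + 1)) (σP (n + 1))) (cHat T c 1 m / T) (gapCheck T AP AQ m / 2) := by
  have hp := h.isSpectralPartition hn.le
  have hp' := h.isSpectralPartition hn
  obtain ⟨k, hk, hnk, hk1, hgap⟩ := exists_gap_eq_angularDist AP AQ hn.le
  have hA := h.areMultistepArcs.isArc_left k n hk hnk
  have hB := h.areMultistepArcs.isArc_right k n hk hnk
  have hAB := h.areMultistepArcs.disjoint k n hk hnk
  have hs := h.spectrum_subset hk hnk (Nat.zero_le k)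
  have hs' := h.spectrum_subset hk hnk (hk1 hn)
  have hδ : gapCheck T AP AQ m / 2 ≤ angularDist (AP k n) (AQ k n) / 2 := by
    rw [← hgap]
    gcongr
    exact gapCheck_le (by lia) hn.le
  refine
    { mem_unitary := h.mem_unitary n hn.le
      isStarProjection_left := hp.isStarProjection
      isStarProjection_right := hp'.isStarProjection
      commute_left := hp.commute
      commute_right := hp'.commute
      pos := half_pos (h.gapCheck_pos (by lia))
      norm_sub_le := h.norm_sub_le hn (by lia)
      sylvesterBound := (hp'.sylvesterBound hp hA hB hAB (Set.union_subset hs'.1 hs.1)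
        (Set.union_subset hs'.2 hs.2)).mono hδ
      sylvesterBound_self := (hp.sylvesterBound hp hA hB hAB (Set.union_subset hs.1 hs.1)
        (Set.union_subset hs.2 hs.2)).mono hδ
      sylvesterSolvable := hp.sylvesterSolvable hA hB hAB hs.1 hs.2 }

lemma isUnit_transferAbs (h : IsGappedWalk T W σP σQ AP AQ c) (hn : n < T)
    (hsmall : 4 * cHat T c 1 n ≤ T * gapCheck T AP AQ n) :
    IsUnit (transferAbs (spectralProj (W (n + 1)) (σP (n + 1))) (spectralProj (W n) (σP n))) := by
  have hT : (0 : ℝ) < T := Nat.cast_pos.2 (by lia)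
  have hstep := h.isAdiabaticStep hn (Or.inl rfl)
  refine DiscreteAdiabatic.isUnit_transferAbs hstep.isStarProjection_left
    hstep.isStarProjection_right (hstep.norm_proj_sub_lt_one ?_)
  rw [← mul_div_assoc, div_le_iff₀ hT]
  linarith

end IsGappedWalk

end GappedWalk

section ErrorBound

/-- The error of the adiabatic approximation after `N` of `T` steps, in terms of the bounds `c₁` and
`c₂` on the first and second differences of the walk and of its gap `Δ`. -/
def errorBound (T : ℕ) (c₁ c₂ Δ : ℕ → ℝ) (N : ℕ) : ℝ :=
  12 * c₁ 0 / (T * Δ 0 ^ 2) + 12 * c₁ N / (T * Δ N ^ 2) + 6 * c₁ N / (T * Δ N)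
  + 305 * ∑ n ∈ Finset.Ico 1 N, c₁ n ^ 2 / ((T : ℝ) ^ 2 * Δ n ^ 3)
  + 44 * ∑ n ∈ Finset.range N, c₁ n ^ 2 / ((T : ℝ) ^ 2 * Δ n ^ 2)
  + 32 * ∑ n ∈ Finset.Ico 1 N, c₂ n / ((T : ℝ) ^ 2 * Δ n ^ 2)

variable {T N M : ℕ} {c₁ c₂ Δ : ℕ → ℝ}

lemma mul_sum_le_errorBound (hc₁ : ∀ n ≤ N, 0 ≤ c₁ n) (hc₂ : ∀ n ∈ Finset.Ico 1 N, 0 ≤ c₂ n)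
    (hΔ : ∀ n ≤ N, 0 < Δ n) :
    44 * ∑ n ∈ Finset.range N, c₁ n ^ 2 / ((T : ℝ) ^ 2 * Δ n ^ 2) ≤ errorBound T c₁ c₂ Δ N := by
  have hc₁0 := hc₁ 0 (Nat.zero_le N)
  have hc₁N := hc₁ N le_rfl
  have hΔ0 := hΔ 0 (Nat.zero_le N)
  have hΔN := hΔ N le_rfl
  have hcube : 0 ≤ ∑ n ∈ Finset.Ico 1 N, c₁ n ^ 2 / ((T : ℝ) ^ 2 * Δ n ^ 3) :=
    Finset.sum_nonneg fun n hn => by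
      have := hΔ n (Finset.mem_Ico.1 hn).2.le
      positivity
  have hsecond : 0 ≤ ∑ n ∈ Finset.Ico 1 N, c₂ n / ((T : ℝ) ^ 2 * Δ n ^ 2) :=
    Finset.sum_nonneg fun n hn => div_nonneg (hc₂ n hn) (by positivity)
  have hboundary : 0 ≤ 12 * c₁ 0 / (T * Δ 0 ^ 2) + 12 * c₁ N / (T * Δ N ^ 2)
      + 6 * c₁ N / (T * Δ N) := by
    positivity
  unfold errorBound
  linarith

lemma errorBound_nonneg (hc₁ : ∀ n ≤ N, 0 ≤ c₁ n) (hc₂ : ∀ n ∈ Finset.Ico 1 N, 0 ≤ c₂ n)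
    (hΔ : ∀ n ≤ N, 0 < Δ n) : 0 ≤ errorBound T c₁ c₂ Δ N := by
  refine le_trans ?_ (mul_sum_le_errorBound hc₁ hc₂ hΔ)
  positivity

lemma two_le_errorBound (hT : 0 < T) (hc₁ : ∀ n ≤ N, 0 ≤ c₁ n)
    (hc₂ : ∀ n ∈ Finset.Ico 1 N, 0 ≤ c₂ n) (hΔ : ∀ n ≤ N, 0 < Δ n)
    (hlarge : ∃ n < N, T * Δ n < 4 * c₁ n) : 2 ≤ errorBound T c₁ c₂ Δ N := by
  obtain ⟨n, hn, hlarge⟩ := hlarge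
  have hTΔ : 0 < T * Δ n := mul_pos (Nat.cast_pos.2 hT) (hΔ n hn.le)
  have hterm : 1 / 16 ≤ c₁ n ^ 2 / ((T : ℝ) ^ 2 * Δ n ^ 2) := by
    rw [← mul_pow, le_div_iff₀ (by positivity)]
    nlinarith
  have hsum := Finset.single_le_sum (f := fun n => c₁ n ^ 2 / ((T : ℝ) ^ 2 * Δ n ^ 2))
    (fun n _ => by positivity) (Finset.mem_range.2 hn)
  linarith [mul_sum_le_errorBound (T := T) hc₁ hc₂ hΔ]

lemma div_div_div_two_pow (x t y : ℝ) (k : ℕ) :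
    x / t / (y / 2) ^ k = 2 ^ k * (x / (t * y ^ k)) := by
  rw [div_div, div_pow, mul_div_assoc', div_div_eq_mul_div, mul_comm x, mul_div_assoc]

lemma sum_range_le_of_small (hT : 0 < T) (hc₁ : 0 ≤ c₁ 0) (hΔ : 0 < Δ 0)
    (hsmall : 4 * c₁ 0 ≤ T * Δ 0) :
    16 * ∑ n ∈ Finset.range (M + 1), c₁ n ^ 2 / ((T : ℝ) ^ 2 * Δ n ^ 3) ≤
      4 * (c₁ 0 / (T * Δ 0 ^ 2))
      + 16 * ∑ n ∈ Finset.Ico 1 (M + 1), c₁ n ^ 2 / ((T : ℝ) ^ 2 * Δ n ^ 3) := by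
  have : (0 : ℝ) < T := Nat.cast_pos.2 hT
  rw [Finset.range_eq_Ico, Finset.sum_eq_sum_Ico_succ_bot M.succ_pos, mul_add]
  refine add_le_add ?_ le_rfl
  calc 16 * (c₁ 0 ^ 2 / ((T : ℝ) ^ 2 * Δ 0 ^ 3))
      = 4 * (c₁ 0 / (T * Δ 0 ^ 2)) * (4 * c₁ 0 / (T * Δ 0)) := by
        field_simp
        ring
    _ ≤ 4 * (c₁ 0 / (T * Δ 0 ^ 2)) * 1 := by
        gcongr
        exact (div_le_one (by positivity)).2 hsmall
    _ = 4 * (c₁ 0 / (T * Δ 0 ^ 2)) := mul_one _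

lemma le_errorBound_of_small (hT : 0 < T) (hc₁ : ∀ n ≤ M + 1, 0 ≤ c₁ n)
    (hc₂ : ∀ n ∈ Finset.Ico 1 (M + 1), 0 ≤ c₂ n) (hΔ : ∀ n ≤ M + 1, 0 < Δ n)
    (hsmall : 4 * c₁ 0 ≤ T * Δ 0) :
    c₁ 0 / T / (Δ 0 / 2) ^ 2 + c₁ (M + 1) / T / (Δ (M + 1) / 2) ^ 2
      + ∑ n ∈ Finset.Ico 1 (M + 1), (c₂ n / (T : ℝ) ^ 2 / (Δ n / 2) ^ 2
          + 12 * ((c₁ n / T) ^ 2 / (Δ n / 2) ^ 3) + (c₁ n / T) ^ 2 / (Δ n / 2) ^ 2)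
      + ∑ n ∈ Finset.range (M + 1),
          2 * ((c₁ n / T) ^ 2 / (Δ n / 2) ^ 2 + (c₁ n / T) ^ 2 / (Δ n / 2) ^ 3) ≤
      errorBound T c₁ c₂ Δ (M + 1) := by
  simp only [div_pow (c₁ _) (T : ℝ), div_div_div_two_pow, Finset.sum_add_distrib,
    ← Finset.mul_sum, mul_add]
  have hfirst := sum_range_le_of_small (M := M) hT (hc₁ 0 (by lia)) (hΔ 0 (by lia)) hsmall
  have hsub : ∑ n ∈ Finset.Ico 1 (M + 1), c₁ n ^ 2 / ((T : ℝ) ^ 2 * Δ n ^ 2) ≤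
      ∑ n ∈ Finset.range (M + 1), c₁ n ^ 2 / ((T : ℝ) ^ 2 * Δ n ^ 2) :=
    Finset.sum_le_sum_of_subset_of_nonneg (fun n hn => by simp_all) fun n _ _ => by positivity
  have hsq : 0 ≤ ∑ n ∈ Finset.range (M + 1), c₁ n ^ 2 / ((T : ℝ) ^ 2 * Δ n ^ 2) := by positivity
  have hcube : 0 ≤ ∑ n ∈ Finset.Ico 1 (M + 1), c₁ n ^ 2 / ((T : ℝ) ^ 2 * Δ n ^ 3) :=
    Finset.sum_nonneg fun n hn => by
      have := hΔ n (Finset.mem_Ico.1 hn).2.le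
      positivity
  have hsecond : 0 ≤ ∑ n ∈ Finset.Ico 1 (M + 1), c₂ n / ((T : ℝ) ^ 2 * Δ n ^ 2) :=
    Finset.sum_nonneg fun n hn => div_nonneg (hc₂ n hn) (by positivity)
  have hc₁0 := hc₁ 0 (by lia)
  have hc₁N := hc₁ (M + 1) le_rfl
  have hΔN := hΔ (M + 1) le_rfl
  have h0 : 0 ≤ c₁ 0 / (T * Δ 0 ^ 2) := by positivity
  have hN : 0 ≤ c₁ (M + 1) / (T * Δ (M + 1) ^ 2) := by positivity
  have hN' : 0 ≤ 6 * c₁ (M + 1) / (T * Δ (M + 1)) := by positivity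
  simp only [errorBound, mul_div_assoc] at hN' ⊢
  linarith

end ErrorBound

section Bounds

variable {H : Type*} [NormedAddCommGroup H] [InnerProductSpace ℂ H] [CompleteSpace H]
  {T N M : ℕ} {W : ℕ → H →L[ℂ] H} {σP σQ : ℕ → Set ℂ} {AP AQ : ℕ → ℕ → Set ℂ} {c : ℕ → ℕ → ℝ}

namespace IsGappedWalk

lemma norm_le_one (h : IsGappedWalk T W σP σQ AP AQ c) {n : ℕ} (hn : n ≤ T) : ‖W n‖ ≤ 1 :=
  norm_le_one_of_mul_star_eq_one (Unitary.mul_star_self_of_mem (h.mem_unitary n hn))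

lemma norm_evolution_le (h : IsGappedWalk T W σP σQ AP AQ c) (hN : N ≤ T) :
    ‖evolution W N‖ ≤ 1 :=
  DiscreteAdiabatic.norm_evolution_le (fun _ hn => h.norm_le_one (hn.le.trans hN)) N le_rfl

lemma norm_adiabaticEvolution_le (h : IsGappedWalk T W σP σQ AP AQ c) (hN : N ≤ T)
    (hV : ∀ n < N,
      IsUnit (transferAbs (spectralProj (W (n + 1)) (σP (n + 1))) (spectralProj (W n) (σP n)))) :
    ‖adiabaticEvolution W σP N‖ ≤ 1 :=
  DiscreteAdiabatic.norm_evolution_le (fun n hn => (norm_mul_le _ _).trans <|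
    mul_le_one₀ (norm_transferV_le (hV n hn)) (norm_nonneg _) (h.norm_le_one (hn.le.trans hN)))
    N le_rfl

lemma norm_evolution_sub_le (h : IsGappedWalk T W σP σQ AP AQ c) (hN : M + 1 ≤ T)
    (hsmall : ∀ n < M + 1, 4 * cHat T c 1 n ≤ T * gapCheck T AP AQ n) :
    ‖evolution W (M + 1) - adiabaticEvolution W σP (M + 1)‖ ≤
      errorBound T (cHat T c 1) (cHat T c 2) (gapCheck T AP AQ) (M + 1) := by
  have hT : (0 : ℝ) < T := Nat.cast_pos.2 (by lia)
  have hdist := norm_evolution_sub_le_of_isAdiabaticStep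
    (M := M) (P := fun n => spectralProj (W n) (σP n)) (a := fun n => cHat T c 1 n / T)
    (b := fun n => cHat T c 2 n / (T : ℝ) ^ 2) (δ := fun n => gapCheck T AP AQ n / 2)
    (fun n hn m hm => h.isAdiabaticStep (show n < T by lia) hm)
    (fun n hn => by
      rw [← mul_div_assoc, div_le_iff₀ hT]
      linarith [hsmall n (by lia)])
    (fun n hn => h.norm_second_diff_le (show n + 2 ≤ T by lia))
  refine hdist.trans (le_errorBound_of_small (by lia)
    (fun n hn => h.cHat_one_nonneg (by lia) (hn.trans hN)) (fun n hn => ?_)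
    (fun n hn => h.gapCheck_pos (hn.trans hN)) (hsmall 0 M.succ_pos))
  rw [Finset.mem_Ico] at hn
  exact h.cHat_two_nonneg hn.1 (hn.2.trans_le hN)

end IsGappedWalk

end Bounds

end DiscreteAdiabatic

end

open DiscreteAdiabatic in
theorem theorem3_general {H : Type*} [NormedAddCommGroup H] [InnerProductSpace ℂ H]
    [CompleteSpace H] {T : ℕ} (hT : 0 < T) {W : ℕ → H →L[ℂ] H} {σP σQ : ℕ → Set ℂ}
    {AP AQ : ℕ → ℕ → Set ℂ} {c : ℕ → ℕ → ℝ} (h : IsGappedWalk T W σP σQ AP AQ c)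
    {N : ℕ} (hN : N ≤ T)
    (hV : ∀ n < N,
      IsUnit (transferAbs (spectralProj (W (n + 1)) (σP (n + 1))) (spectralProj (W n) (σP n)))) :
    ‖evolution W N - adiabaticEvolution W σP N‖ ≤
      errorBound T (cHat T c 1) (cHat T c 2) (gapCheck T AP AQ) N := by
  have hc₁ : ∀ n ≤ N, 0 ≤ cHat T c 1 n := fun n hn => h.cHat_one_nonneg hT (hn.trans hN)
  have hc₂ : ∀ n ∈ Finset.Ico 1 N, 0 ≤ cHat T c 2 n := fun n hn =>
    h.cHat_two_nonneg (Finset.mem_Ico.1 hn).1 ((Finset.mem_Ico.1 hn).2.trans_le hN)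
  have hΔ : ∀ n ≤ N, 0 < gapCheck T AP AQ n := fun n hn => h.gapCheck_pos (hn.trans hN)
  by_cases hsmall : ∀ n < N, 4 * cHat T c 1 n ≤ T * gapCheck T AP AQ n
  · rcases N with _ | M
    · simpa [adiabaticEvolution, evolution] using errorBound_nonneg hc₁ hc₂ hΔ
    · exact h.norm_evolution_sub_le hN hsmall
  · push Not at hsmall
    calc _ ≤ ‖evolution W N‖ + ‖adiabaticEvolution W σP N‖ := norm_sub_le _ _
      _ ≤ 1 + 1 := add_le_add (h.norm_evolution_le hN) (h.norm_adiabaticEvolution_le hN hV)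
      _ = 2 := one_add_one_eq_two
      _ ≤ _ := two_le_errorBound hT hc₁ hc₂ hΔ hsmall

theorem theorem3 {H : Type*} [NormedAddCommGroup H] [InnerProductSpace ℂ H] [CompleteSpace H]
    (T : ℕ) (hT : 0 < T)
    -- the walk operators `W_T(n / T)`, `n = 0, …, T`
    (W : ℕ → H →L[ℂ] H) (hW : ∀ n ≤ T, W n ∈ unitary (H →L[ℂ] H))
    -- the spectrum of interest, the complementary spectrum, and the arcs around them
    (σP σQ : ℕ → Set ℂ)
    (hσ : ∀ n ≤ T, σP n ∪ σQ n = spectrum ℂ (W n) ∧ Disjoint (σP n) (σQ n))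
    (AP AQ : ℕ → ℕ → Set ℂ) (hA : DiscreteAdiabatic.AreMultistepArcs T σP σQ AP AQ)
    -- the bounds on the first and second differences
    (c : ℕ → ℕ → ℝ)
    (hc : ∀ k n, k = 1 ∨ k = 2 → n + k ≤ T → ‖(fwdDiff 1)^[k] W n‖ ≤ c k n / (T : ℝ) ^ k)
    -- the lower bound on the number of steps
    (hcT : ∀ n ≤ T, 4 * DiscreteAdiabatic.cHat T c 1 n / DiscreteAdiabatic.gapCheck T AP AQ n
      ≤ (T : ℝ))
    -- the time `s = N / T`
    (N : ℕ) (hN : N ≤ T) :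
    ‖DiscreteAdiabatic.evolution W N - DiscreteAdiabatic.adiabaticEvolution W σP N‖ ≤
      12 * DiscreteAdiabatic.cHat T c 1 0 / (T * DiscreteAdiabatic.gapCheck T AP AQ 0 ^ 2)
      + 12 * DiscreteAdiabatic.cHat T c 1 N / (T * DiscreteAdiabatic.gapCheck T AP AQ N ^ 2)
      + 6 * DiscreteAdiabatic.cHat T c 1 N / (T * DiscreteAdiabatic.gapCheck T AP AQ N)
      + 305 * ∑ n ∈ Finset.Ico 1 N, DiscreteAdiabatic.cHat T c 1 n ^ 2
          / ((T : ℝ) ^ 2 * DiscreteAdiabatic.gapCheck T AP AQ n ^ 3)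
      + 44 * ∑ n ∈ Finset.range N, DiscreteAdiabatic.cHat T c 1 n ^ 2
          / ((T : ℝ) ^ 2 * DiscreteAdiabatic.gapCheck T AP AQ n ^ 2)
      + 32 * ∑ n ∈ Finset.Ico 1 N, DiscreteAdiabatic.cHat T c 2 n
          / ((T : ℝ) ^ 2 * DiscreteAdiabatic.gapCheck T AP AQ n ^ 2) :=
  have h : DiscreteAdiabatic.IsGappedWalk T W σP σQ AP AQ c :=
    ⟨hW, fun n hn => (hσ n hn).1, hA, hc⟩
  theorem3_general hT h hN fun n hn => h.isUnit_transferAbs (hn.trans_le hN) <|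
    (div_le_iff₀ (h.gapCheck_pos (hn.le.trans hN))).1 (hcT n (hn.le.trans hN))
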